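/- Let $p\in\mathbb{C}\setminus\{0\}$, let $k,m\in\{0,1,2\}$ with $k+m\not\equiv 0 \pmod 3$, and let $\zeta=e^{2\pi i/3}$. Put $$E_{123}=1,\quad E_{132}=p,\quad E_{213}=p\zeta^{k},\quad E_{231}=\zeta^{m},\quad E_{312}=\zeta^{-m},\quad E_{321}=p\zeta^{-k},$$ and $E_{abc}=0$ whenever $(a,b,c)$ is not a permutation of $(1,2,3)$. Let $\mathsf A=C(A_{p,k,m}(3))$ be the universal unital $C^*$-algebra generated by elements $u_{ij}$, $i,j\in\{1,2,3\}$, subject to the relations $$\sum_{s=1}^{3}u_{js}u_{ks}^*=\delta_{jk}1=\sum_{s=1}^{3}u_{sj}^*u_{sk},\qquad \sum_{i,j,l=1}^{3}E_{ijl}\,u_{ai}u_{bj}u_{cl}=E_{abc}\,1\qquad (a,b,c\in\{1,2,3\}).$$ For $\theta\in\mathbb{R}$ let $A_\theta$ be the rotation algebra, that is, the universal unital $C^*$-algebra generated by two unitaries $v_1,v_2$ with $v_1v_2=e^{2\pi i\theta}v_2v_1$. Representations are unital $*$-representations on complex Hilbert spaces; a representation is irreducible if its space is non-zero and has no closed invariant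 subspaces other than $\{0\}$ and the whole space. Then the irreducible representations $\pi$ of $\mathsf A$ on Hilbert spaces $H$ are exactly those in the following three families. 1. $\dim H=1$ and, for some $z_1,z_2\in\mathbb{C}$ with $|z_1|=|z_2|=1$, $\pi(u_{11})=z_1$, $\pi(u_{22})=z_2$, $\pi(u_{33})=\bar z_1\bar z_2$, and $\pi(u_{ij})=0$ for $i\neq j$. 2. For some irreducible representation $\pi_\theta$ of $A_\theta$ on $H$, where $\theta=\frac{k-m}{3}$, $$\pi(u_{12})=\pi_\theta(v_1),\quad \pi(u_{23})=\pi_\theta(v_2),\quad \pi(u_{31})=\zeta^{-m}\pi_\theta(v_2^*v_1^*),$$ and $\pi(u_{ij})=0$ for all other $i,j$. 3. For some irreducible representation $\pi_{\theta'}$ of $A_{\theta'}$ on $H$, where $\theta'=\frac{m-k}{3}$ and the generators of $A_{\theta'}$ are denoted $w_1,w_2$, $$\pi(u_{13})=\pi_{\theta'}(w_1),\quad \pi(u_{21})=\pi_{\theta'}(w_2),\quad \pi(u_{32})=\zeta^{m}\pi_{\theta'}(w_2^*w_1^*),$$ and $\pi(u_{ij})=0$ for all other $i,j$. Moreover, every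 choice of $z_1,z_2$ (on a one-dimensional $H$), of $\pi_\theta$, and of $\pi_{\theta'}$ as above occurs, for exactly one representation $\pi$ of $\mathsf A$ on $H$. -/

import Mathlib

open UniformSpace

noncomputable section

/-! ### The free unital complex `*`-algebra on a set of generators -/

/-- The free unital complex `*`-algebra on `X`: complex combinations of words in the letters
`x = (x, false)` and `x* = (x, true)`. -/
def FreeStarAlgebra (X : Type) : Type := MonoidAlgebra ℂ (FreeMonoid (X × Bool))

namespace FreeStarAlgebra

variable {X : Type}

instance : Ring (FreeStarAlgebra X) :=
  inferInstanceAs (Ring (MonoidAlgebra ℂ (FreeMonoid (X × Bool))))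

instance : Algebra ℂ (FreeStarAlgebra X) :=
  inferInstanceAs (Algebra ℂ (MonoidAlgebra ℂ (FreeMonoid (X × Bool))))

/-- The letter `x` (for `b = false`) or `x*` (for `b = true`). -/
def letter (x : X) (b : Bool) : FreeStarAlgebra X :=
  MonoidAlgebra.of ℂ (FreeMonoid (X × Bool)) (FreeMonoid.of (x, b))

/-- The generator `x`. -/
def gen (x : X) : FreeStarAlgebra X := letter x false

/-- The involution, as a ring homomorphism into the opposite ring: it conjugates scalars and
exchanges `x` and `x*`. -/
def starHom : FreeStarAlgebra X →+* (FreeStarAlgebra X)ᵐᵒᵖ :=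
  MonoidAlgebra.liftNCRingHom
    ((algebraMap ℂ (FreeStarAlgebra X)ᵐᵒᵖ).comp (starRingEnd ℂ))
    (FreeMonoid.lift fun a : X × Bool => MulOpposite.op (letter a.1 (!a.2)))
    (fun c _ => Algebra.commutes (starRingEnd ℂ c) _)

theorem starHom_algebraMap (c : ℂ) :
    starHom (algebraMap ℂ (FreeStarAlgebra X) c)
      = MulOpposite.op (algebraMap ℂ (FreeStarAlgebra X) (starRingEnd ℂ c)) := by
  refine (MonoidAlgebra.liftNCRingHom_single _ _ _ 1 c).trans ?_
  simp [MulOpposite.algebraMap_apply]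

theorem starHom_letter (x : X) (b : Bool) :
    starHom (letter x b) = MulOpposite.op (letter x (!b)) := by
  refine (MonoidAlgebra.liftNCRingHom_single _ _ _ (FreeMonoid.of (x, b)) 1).trans ?_
  simp

/-- Induction principle: scalars, letters, sums and products exhaust the free `*`-algebra. -/
theorem induction {P : FreeStarAlgebra X → Prop} (hc : ∀ c : ℂ, P (algebraMap ℂ _ c))
    (hl : ∀ x b, P (letter x b)) (ha : ∀ a b, P a → P b → P (a + b))
    (hm : ∀ a b, P a → P b → P (a * b)) (a : FreeStarAlgebra X) : P a := by
  refine MonoidAlgebra.induction_on (motive := P) a ?_ ha ?_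
  · intro w
    induction w using FreeMonoid.inductionOn' with
    | one =>
      have h := hc 1
      rw [map_one] at h
      exact h
    | of_mul a w ih =>
      rw [map_mul]
      exact hm _ _ (hl a.1 a.2) ih
  · intro c a h
    exact (Algebra.smul_def (A := FreeStarAlgebra X) c a).symm ▸ hm _ _ (hc c) h

instance : StarRing (FreeStarAlgebra X) where
  star a := (starHom a).unop
  star_involutive a := by
    refine induction (P := fun a => (starHom (starHom a).unop).unop = a) ?_ ?_ ?_ ?_ a
    · intro c; simp [starHom_algebraMap]
    · intro x b; simp [starHom_letter]
    · intro a b ha hb; simp [ha, hb]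
    · intro a b ha hb; simp [ha, hb]
  star_mul a b := by simp
  star_add a b := by simp

theorem star_def (a : FreeStarAlgebra X) : star a = (starHom a).unop := rfl

instance : StarModule ℂ (FreeStarAlgebra X) where
  star_smul c a := by
    rw [Algebra.smul_def, star_mul, star_def (algebraMap ℂ _ c), starHom_algebraMap,
      MulOpposite.unop_op, ← Algebra.commutes, ← Algebra.smul_def]
    rfl

theorem star_letter (x : X) (b : Bool) : star (letter x b) = letter x (!b) := by
  rw [star_def, starHom_letter, MulOpposite.unop_op]

/-- Evaluation of a noncommutative `*`-polynomial at elements `v x` of a unital complex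
`*`-algebra. -/
def eval {B : Type*} [Ring B] [StarRing B] [Algebra ℂ B] [StarModule ℂ B] (v : X → B) :
    FreeStarAlgebra X →⋆ₐ[ℂ] B where
  __ := (MonoidAlgebra.lift ℂ B (FreeMonoid (X × Bool))
    (FreeMonoid.lift fun a : X × Bool => if a.2 then star (v a.1) else v a.1) :
      FreeStarAlgebra X →ₐ[ℂ] B)
  map_star' a := by
    set f : FreeStarAlgebra X →ₐ[ℂ] B := MonoidAlgebra.lift ℂ B (FreeMonoid (X × Bool))
      (FreeMonoid.lift fun a : X × Bool => if a.2 then star (v a.1) else v a.1) with hf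
    have hl : ∀ x b, f (letter x b) = if b then star (v x) else v x := by
      intro x b
      refine (MonoidAlgebra.lift_of _ _).trans ?_
      simp
    change f (star a) = star (f a)
    refine induction (P := fun a => f (star a) = star (f a)) ?_ ?_ ?_ ?_ a
    · intro c
      rw [AlgHom.commutes, Algebra.algebraMap_eq_smul_one, star_smul, star_one, map_smul, map_one,
        Algebra.algebraMap_eq_smul_one, star_smul, star_one]
    · intro x b
      rw [star_letter, hl, hl]
      cases b <;> simp
    · intro a b ha hb; simp [ha, hb]
    · intro a b ha hb; simp [ha, hb]

@[simp]
theorem eval_gen {B : Type*} [Ring B] [StarRing B] [Algebra ℂ B] [StarModule ℂ B] (v : X → B)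
    (x : X) : eval v (gen x) = v x := by
  refine (MonoidAlgebra.lift_of _ _).trans ?_
  simp

end FreeStarAlgebra

/-! ### C⋆-seminorms and the C⋆-algebras obtained by completion -/

/-- A C⋆-seminorm on a unital complex `*`-algebra: a submultiplicative seminorm with
`p (a* a) = p (a) ^ 2`. -/
structure CStarSeminorm (F : Type) [Ring F] [StarRing F] [Algebra ℂ F] extends
    Seminorm ℂ F where
  mul_le' : ∀ a b, toFun (a * b) ≤ toFun a * toFun b
  star_mul_self' : ∀ a, toFun (star a * a) = toFun a * toFun a

namespace CStarSeminorm

section Completion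

variable {F : Type} [Ring F] [StarRing F] [Algebra ℂ F]

theorem star_le (p : CStarSeminorm F) (a : F) : p.toSeminorm (star a) ≤ p.toSeminorm a := by
  have h1 := p.star_mul_self' (star a)
  have h2 := p.mul_le' (star (star a)) (star a)
  change p.toSeminorm _ = p.toSeminorm _ * p.toSeminorm _ at h1
  change p.toSeminorm _ ≤ p.toSeminorm _ * p.toSeminorm _ at h2
  rw [star_star] at h1 h2
  rw [h1] at h2
  have h3 : 0 ≤ p.toSeminorm (star a) := apply_nonneg _ _
  have h4 : 0 ≤ p.toSeminorm a := apply_nonneg _ _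
  by_contra h
  push Not at h
  nlinarith

/-- The algebra `F`, regarded as a topological algebra by means of the seminorm `p`. -/
def Carrier (_p : CStarSeminorm F) : Type := F

variable (p : CStarSeminorm F)

instance : Ring p.Carrier := inferInstanceAs (Ring F)
instance : StarRing p.Carrier := inferInstanceAs (StarRing F)
instance : Algebra ℂ p.Carrier := inferInstanceAs (Algebra ℂ F)
instance [StarModule ℂ F] : StarModule ℂ p.Carrier := inferInstanceAs (StarModule ℂ F)

instance : SeminormedRing p.Carrier where
  __ := (inferInstance : Ring p.Carrier)
  __ := AddGroupSeminorm.toSeminormedAddCommGroup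
    (E := p.Carrier) (p.toSeminorm.toAddGroupSeminorm : AddGroupSeminorm F)
  norm_mul_le := p.mul_le'

theorem norm_carrier (a : p.Carrier) : ‖a‖ = p.toSeminorm (show F from a) := rfl

instance : NormedSpace ℂ p.Carrier where
  norm_smul_le c a := (map_smul_eq_mul p.toSeminorm c (show F from a)).le

instance : NormedStarGroup p.Carrier where
  norm_star_le a := p.star_le a

instance : NormedAlgebra ℂ p.Carrier where
  norm_smul_le := norm_smul_le

/-- The Hausdorff completion of `F` with respect to the C⋆-seminorm `p`. -/
def Complete : Type := Completion p.Carrier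

instance : NormedRing p.Complete := inferInstanceAs (NormedRing (Completion p.Carrier))
instance : CompleteSpace p.Complete := inferInstanceAs (CompleteSpace (Completion p.Carrier))
instance : Algebra ℂ p.Complete := inferInstanceAs (Algebra ℂ (Completion p.Carrier))

instance : NormedAlgebra ℂ p.Complete where
  norm_smul_le c a := norm_smul_le (β := Completion p.Carrier) c a

/-- The canonical map of `F` into the completion. -/
def coe (a : F) : p.Complete := ((show p.Carrier from a : p.Carrier) : Completion p.Carrier)

theorem coe_add (a b : F) : p.coe (a + b) = p.coe a + p.coe b :=
  Completion.coe_add (α := p.Carrier) a b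

theorem coe_mul (a b : F) : p.coe (a * b) = p.coe a * p.coe b :=
  Completion.coe_mul (α := p.Carrier) a b

theorem coe_algebraMap (c : ℂ) : p.coe (algebraMap ℂ F c) = algebraMap ℂ p.Complete c := rfl

theorem norm_coe (a : F) : ‖p.coe a‖ = p.toSeminorm a :=
  Completion.norm_coe (E := p.Carrier) a

theorem denseRange_coe : DenseRange p.coe :=
  Completion.denseRange_coe (α := p.Carrier)

/-- The involution of the completion is the continuous extension of that of `F`. -/
instance : Star p.Complete where
  star := Completion.map (star : p.Carrier → p.Carrier)

theorem continuous_star_complete : Continuous (star : p.Complete → p.Complete) :=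
  Completion.continuous_map (f := (star : p.Carrier → p.Carrier))

theorem star_coe (a : F) : star (p.coe a) = p.coe (star a) :=
  Completion.map_coe (starNormedAddGroupHom (E := p.Carrier)).uniformContinuous a

instance : StarRing p.Complete where
  star_involutive := by
    refine congr_fun (p.denseRange_coe.equalizer
      (p.continuous_star_complete.comp p.continuous_star_complete) continuous_id ?_)
    funext a
    simp [star_coe]
  star_mul a b := by
    refine p.denseRange_coe.induction_on₂ (p := fun a b => star (a * b) = star b * star a)
      ?_ ?_ a b
    · have := p.continuous_star_complete
      exact isClosed_eq (by fun_prop) (by fun_prop)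
    · intro a b
      simp [star_coe, ← coe_mul]
  star_add a b := by
    refine p.denseRange_coe.induction_on₂ (p := fun a b => star (a + b) = star a + star b)
      ?_ ?_ a b
    · have := p.continuous_star_complete
      exact isClosed_eq (by fun_prop) (by fun_prop)
    · intro a b
      simp [star_coe, ← coe_add]

theorem coe_smul (c : ℂ) (a : F) : p.coe (c • a) = c • p.coe a := by
  rw [Algebra.smul_def, coe_mul, coe_algebraMap, Algebra.smul_def]

theorem norm_star_mul_self_complete (a : p.Complete) : ‖star a * a‖ = ‖a‖ * ‖a‖ := by
  refine p.denseRange_coe.induction_on (p := fun a => ‖star a * a‖ = ‖a‖ * ‖a‖) a ?_ ?_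
  · have := p.continuous_star_complete
    exact isClosed_eq (by fun_prop) (by fun_prop)
  · intro a
    rw [star_coe, ← coe_mul, norm_coe, norm_coe]
    exact p.star_mul_self' a

instance [StarModule ℂ F] : StarModule ℂ p.Complete where
  star_smul c a := by
    refine p.denseRange_coe.induction_on (p := fun a => star (c • a) = star c • star a) a ?_ ?_
    · exact isClosed_eq (p.continuous_star_complete.comp (continuous_const_smul c))
        (p.continuous_star_complete.const_smul (star c))
    · intro a
      rw [← coe_smul, star_coe, star_coe, star_smul, coe_smul]

instance [StarModule ℂ F] : CStarAlgebra p.Complete where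
  norm_mul_self_le a := (p.norm_star_mul_self_complete a).ge

/-- The canonical `*`-homomorphism of `F` into the completion. -/
def coeHom : F →⋆ₐ[ℂ] p.Complete where
  toFun := p.coe
  map_one' := rfl
  map_mul' := p.coe_mul
  map_zero' := rfl
  map_add' := p.coe_add
  commutes' := p.coe_algebraMap
  map_star' a := (p.star_coe a).symm

end Completion

end CStarSeminorm

/-! ### Universal C⋆-algebras -/

/-- A C⋆-seminorm on the free `*`-algebra is admissible for a set of relations if it vanishes on
all of them. -/
def Admissible {X : Type} (R : Set (FreeStarAlgebra X)) (p : CStarSeminorm (FreeStarAlgebra X)) :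
    Prop :=
  ∀ r ∈ R, p.toSeminorm r = 0

/-- Generators and relations which define a universal unital C⋆-algebra. Every element `r` of `rel`
stands for the relation `r = 0`. As usual, the admissible C⋆-seminorms have to be bounded on each
generator. -/
structure CStarPresentation (X : Type) where
  rel : Set (FreeStarAlgebra X)
  bounded : ∀ x, ∃ C : ℝ, ∀ p, Admissible rel p → p.toSeminorm (FreeStarAlgebra.gen x) ≤ C

namespace CStarPresentation

variable {X : Type} (P : CStarPresentation X)

/-- The zero seminorm is admissible. -/
instance : Nonempty {p : CStarSeminorm (FreeStarAlgebra X) // Admissible P.rel p} :=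
  ⟨⟨{ toSeminorm := 0
      mul_le' := fun _ _ => by
        change (0 : ℝ) ≤ 0 * 0
        simp
      star_mul_self' := fun _ => by
        change (0 : ℝ) = 0 * 0
        simp }, fun _ _ => rfl⟩⟩

theorem bddAbove (a : FreeStarAlgebra X) :
    BddAbove (Set.range fun p : {p : CStarSeminorm (FreeStarAlgebra X) // Admissible P.rel p} =>
      p.1.toSeminorm a) := by
  suffices h : ∃ C : ℝ, ∀ p, Admissible P.rel p → p.toSeminorm a ≤ C by
    obtain ⟨C, hC⟩ := h
    exact ⟨C, by rintro _ ⟨p, rfl⟩; exact hC p.1 p.2⟩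
  refine FreeStarAlgebra.induction
    (P := fun a => ∃ C : ℝ, ∀ p, Admissible P.rel p → p.toSeminorm a ≤ C) ?_ ?_ ?_ ?_ a
  · intro c
    refine ⟨‖c‖, fun p _ => ?_⟩
    have h1 : p.toSeminorm (1 : FreeStarAlgebra X) ≤ 1 := by
      have h := p.star_mul_self' 1
      change p.toSeminorm _ = p.toSeminorm _ * p.toSeminorm _ at h
      rw [star_one, one_mul] at h
      nlinarith [sq_nonneg (p.toSeminorm (1 : FreeStarAlgebra X) - 1)]
    rw [Algebra.algebraMap_eq_smul_one, map_smul_eq_mul]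
    exact mul_le_of_le_one_right (norm_nonneg _) h1
  · intro x b
    obtain ⟨C, hC⟩ := P.bounded x
    refine ⟨C, fun p hp => ?_⟩
    cases b
    · exact hC p hp
    · have h := p.star_le (FreeStarAlgebra.gen x)
      rw [FreeStarAlgebra.gen, FreeStarAlgebra.star_letter] at h
      exact h.trans (hC p hp)
  · rintro a b ⟨C, hC⟩ ⟨D, hD⟩
    exact ⟨C + D, fun p hp => (map_add_le_add _ _ _).trans (add_le_add (hC p hp) (hD p hp))⟩
  · rintro a b ⟨C, hC⟩ ⟨D, hD⟩
    refine ⟨C * D, fun p hp => (p.mul_le' a b).trans ?_⟩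
    exact mul_le_mul (hC p hp) (hD p hp) (apply_nonneg p.toSeminorm _)
      ((apply_nonneg p.toSeminorm _).trans (hC p hp))

/-- The value at `a` of the largest admissible C⋆-seminorm. -/
def univNorm (a : FreeStarAlgebra X) : ℝ :=
  ⨆ p : {p : CStarSeminorm (FreeStarAlgebra X) // Admissible P.rel p}, p.1.toSeminorm a

theorem le_univNorm {p : CStarSeminorm (FreeStarAlgebra X)} (hp : Admissible P.rel p)
    (a : FreeStarAlgebra X) : p.toSeminorm a ≤ P.univNorm a :=
  le_ciSup (P.bddAbove a) ⟨p, hp⟩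

theorem univNorm_le {a : FreeStarAlgebra X} {C : ℝ}
    (h : ∀ p, Admissible P.rel p → p.toSeminorm a ≤ C) : P.univNorm a ≤ C :=
  ciSup_le fun p => h p.1 p.2

theorem univNorm_nonneg (a : FreeStarAlgebra X) : 0 ≤ P.univNorm a :=
  Real.iSup_nonneg fun p => apply_nonneg p.1.toSeminorm a

/-- The largest admissible C⋆-seminorm. -/
def univSeminorm : CStarSeminorm (FreeStarAlgebra X) where
  toSeminorm := Seminorm.of P.univNorm
    (fun a b => P.univNorm_le fun _ hp => (map_add_le_add _ _ _).trans
      (add_le_add (P.le_univNorm hp a) (P.le_univNorm hp b)))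
    (fun c a => by
      simp only [univNorm, map_smul_eq_mul]
      exact (Real.mul_iSup_of_nonneg (norm_nonneg c) _).symm)
  mul_le' a b := P.univNorm_le fun p hp => (p.mul_le' a b).trans
    (mul_le_mul (P.le_univNorm hp a) (P.le_univNorm hp b) (apply_nonneg p.toSeminorm _)
      (P.univNorm_nonneg a))
  star_mul_self' a := by
    change P.univNorm (star a * a) = P.univNorm a * P.univNorm a
    apply le_antisymm
    · refine P.univNorm_le fun p hp => (p.star_mul_self' a).le.trans ?_
      exact mul_le_mul (P.le_univNorm hp a) (P.le_univNorm hp a) (apply_nonneg p.toSeminorm _)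
        (P.univNorm_nonneg a)
    · have h : P.univNorm a ≤ √(P.univNorm (star a * a)) := by
        refine P.univNorm_le fun p hp => Real.le_sqrt_of_sq_le ?_
        rw [pow_two]
        exact (p.star_mul_self' a).ge.trans (P.le_univNorm hp _)
      calc P.univNorm a * P.univNorm a
          ≤ √(P.univNorm (star a * a)) * √(P.univNorm (star a * a)) :=
            mul_self_le_mul_self (P.univNorm_nonneg a) h
        _ = P.univNorm (star a * a) := Real.mul_self_sqrt (P.univNorm_nonneg _)

/-- The universal unital C⋆-algebra given by generators and relations: the completion of the free
`*`-algebra with respect to the largest admissible C⋆-seminorm. -/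
def UniversalAlgebra : Type := P.univSeminorm.Complete

instance : CStarAlgebra P.UniversalAlgebra :=
  inferInstanceAs (CStarAlgebra P.univSeminorm.Complete)

/-- The canonical `*`-homomorphism of the free `*`-algebra into the universal C⋆-algebra. -/
def toUniversal : FreeStarAlgebra X →⋆ₐ[ℂ] P.UniversalAlgebra := P.univSeminorm.coeHom

/-- The generators of the universal C⋆-algebra. -/
def generator (x : X) : P.UniversalAlgebra := P.toUniversal (FreeStarAlgebra.gen x)

theorem norm_toUniversal (a : FreeStarAlgebra X) : ‖P.toUniversal a‖ = P.univNorm a :=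
  P.univSeminorm.norm_coe a

theorem denseRange_toUniversal : DenseRange P.toUniversal := P.univSeminorm.denseRange_coe

theorem toUniversal_eq_zero {r : FreeStarAlgebra X} (hr : r ∈ P.rel) : P.toUniversal r = 0 := by
  rw [← norm_eq_zero, norm_toUniversal]
  exact le_antisymm (P.univNorm_le fun p hp => (hp r hr).le) (P.univNorm_nonneg r)

/-- The universal property: elements of a unital C⋆-algebra which satisfy the relations are the
images of the generators under exactly one unital `*`-homomorphism. -/
theorem existsUnique_hom {B : Type*} [CStarAlgebra B] (v : X → B)
    (hv : ∀ r ∈ P.rel, FreeStarAlgebra.eval v r = 0) :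
    ∃! φ : P.UniversalAlgebra →⋆ₐ[ℂ] B, ∀ x, φ (P.generator x) = v x := by
  let f : FreeStarAlgebra X →⋆ₐ[ℂ] B := FreeStarAlgebra.eval v
  let p : CStarSeminorm (FreeStarAlgebra X) :=
    { toSeminorm := (normSeminorm ℂ B).comp f.toAlgHom.toLinearMap
      mul_le' := fun a b => by
        change ‖f (a * b)‖ ≤ ‖f a‖ * ‖f b‖
        rw [map_mul]
        exact norm_mul_le _ _
      star_mul_self' := fun a => by
        change ‖f (star a * a)‖ = ‖f a‖ * ‖f a‖
        rw [map_mul, map_star, CStarRing.norm_star_mul_self] }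
  have hp : Admissible P.rel p := fun r hr => by
    change ‖f r‖ = 0
    rw [norm_eq_zero]
    exact hv r hr
  have hf : ∀ a, ‖f a‖ ≤ P.univNorm a := fun a => P.le_univNorm hp a
  let g : P.univSeminorm.Carrier →+* B := (f : FreeStarAlgebra X →+* B)
  have hg : Continuous g :=
    AddMonoidHomClass.continuous_of_bound g 1 fun a => (hf a).trans (one_mul _).ge
  let h : P.UniversalAlgebra →+* B := Completion.extensionHom g hg
  have hh : ∀ a, h (P.toUniversal a) = f a := fun a => Completion.extensionHom_coe g hg a
  have hc : Continuous h := Completion.continuous_extension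
  let φ : P.UniversalAlgebra →⋆ₐ[ℂ] B :=
    { h with
      commutes' := fun c => by
        have h1 := hh (algebraMap ℂ _ c)
        rw [AlgHomClass.commutes P.toUniversal, AlgHomClass.commutes f] at h1
        exact h1
      map_star' := by
        have h1 : Continuous fun a : P.UniversalAlgebra => h (star a) := hc.comp continuous_star
        refine congr_fun (P.denseRange_toUniversal.equalizer h1 (continuous_star.comp hc) ?_)
        funext a
        change h (star (P.toUniversal a)) = star (h (P.toUniversal a))
        rw [← map_star, hh, hh, map_star] }
  refine ⟨φ, fun x => (hh _).trans (FreeStarAlgebra.eval_gen v x), fun ψ hψ => ?_⟩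
  have hψc : Continuous ψ := AddMonoidHomClass.continuous_of_bound ψ 1 fun a =>
    (NonUnitalStarAlgHom.norm_apply_le ψ a).trans (one_mul _).ge
  refine DFunLike.coe_injective (P.denseRange_toUniversal.equalizer hψc hc ?_)
  funext a
  change ψ (P.toUniversal a) = h (P.toUniversal a)
  rw [hh]
  refine FreeStarAlgebra.induction (P := fun a => ψ (P.toUniversal a) = f a) ?_ ?_ ?_ ?_ a
  · intro c
    simp only [AlgHomClass.commutes]
  · intro x b
    have h0 : ψ (P.toUniversal (FreeStarAlgebra.letter x false)) =
        f (FreeStarAlgebra.letter x false) := (hψ x).trans (FreeStarAlgebra.eval_gen v x).symm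
    cases b
    · exact h0
    · rw [← Bool.not_false, ← FreeStarAlgebra.star_letter, map_star, map_star, map_star, h0]
  · intro a b ha hb; simp [ha, hb]
  · intro a b ha hb; simp [ha, hb]

end CStarPresentation

/-- In a unital C⋆-algebra, the terms of a sum of elements `a* a` with sum `1` come from elements
of norm at most one. -/
theorem norm_le_one_of_sum_star_mul_self {B ι : Type*} [CStarAlgebra B] [Fintype ι] (a : ι → B)
    (h : ∑ i, star (a i) * a i = 1) (i : ι) : ‖a i‖ ≤ 1 := by
  let _ : PartialOrder B := CStarAlgebra.spectralOrder B
  have : StarOrderedRing B := CStarAlgebra.spectralOrderedRing B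
  have h1 : star (a i) * a i ≤ 1 := by
    rw [← h]
    exact Finset.single_le_sum (f := fun i => star (a i) * a i)
      (fun j _ => star_mul_self_nonneg (a j)) (Finset.mem_univ i)
  have h2 : ‖star (a i) * a i‖ ≤ 1 :=
    (CStarAlgebra.norm_le_one_iff_of_nonneg _ (star_mul_self_nonneg _)).2 h1
  rw [CStarRing.norm_star_mul_self] at h2
  nlinarith [norm_nonneg (a i)]

/-! ### Woronowicz's compact quantum groups in dimension three -/

section Woronowicz

open FreeStarAlgebra

/-- The generator `u i j` in the free `*`-algebra. -/
def uFree (i j : Fin 3) : FreeStarAlgebra (Fin 3 × Fin 3) := gen (i, j)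

/-- The relations imposed on the matrix `u` by an array `E`: the unitarity of `u`, and the twisted
determinant condition. -/
inductive WoronowiczRel (E : Fin 3 → Fin 3 → Fin 3 → ℂ) :
    FreeStarAlgebra (Fin 3 × Fin 3) → Prop
  | mul_star (j k : Fin 3) : WoronowiczRel E
      (∑ s, uFree j s * star (uFree k s) - if j = k then 1 else 0)
  | star_mul (j k : Fin 3) : WoronowiczRel E
      (∑ s, star (uFree s j) * uFree s k - if j = k then 1 else 0)
  | det (a b c : Fin 3) : WoronowiczRel E
      (∑ i, ∑ j, ∑ l, E i j l • (uFree a i * uFree b j * uFree c l) - E a b c • 1)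

/-- The presentation, with generators `u i j`, of the C⋆-algebra of the compact quantum group
which comes from the Woronowicz construction for the array `E`. -/
def woronowiczPresentation (E : Fin 3 → Fin 3 → Fin 3 → ℂ) :
    CStarPresentation (Fin 3 × Fin 3) where
  rel := {r | WoronowiczRel E r}
  bounded x := by
    refine ⟨1, fun p hp => ?_⟩
    have h : p.coeHom (∑ s, star (uFree s x.2) * uFree s x.2 - if x.2 = x.2 then 1 else 0) = 0 := by
      rw [← norm_eq_zero]
      exact (p.norm_coe _).trans (hp _ (WoronowiczRel.star_mul x.2 x.2))
    rw [if_pos rfl, map_sub, map_one, map_sum, sub_eq_zero] at h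
    simp only [map_mul, map_star] at h
    have h1 := norm_le_one_of_sum_star_mul_self (fun s => p.coeHom (uFree s x.2)) h x.1
    exact (p.norm_coe _).ge.trans h1

/-- The root of unity `exp (2πi/3)`. -/
def zeta3 : ℂ := Complex.exp (2 * Real.pi * Complex.I / 3)

/-- The array of the quantum group `A_{p,k,m}(3)`; the indices `1, 2, 3` are written `0, 1, 2`. -/
def akmArray (p : ℂ) (k m : ℕ) : Fin 3 → Fin 3 → Fin 3 → ℂ
  | 0, 1, 2 => 1
  | 0, 2, 1 => p
  | 1, 0, 2 => p * zeta3 ^ k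
  | 1, 2, 0 => zeta3 ^ m
  | 2, 0, 1 => (zeta3 ^ m)⁻¹
  | 2, 1, 0 => p * (zeta3 ^ k)⁻¹
  | _, _, _ => 0

/-- The C⋆-algebra `C(A_{p,k,m}(3))`. -/
abbrev AkmAlgebra (p : ℂ) (k m : ℕ) : Type :=
  (woronowiczPresentation (akmArray p k m)).UniversalAlgebra

/-- The coefficient `u i j` of the fundamental corepresentation of `A_{p,k,m}(3)`. -/
def akmU (p : ℂ) (k m : ℕ) (i j : Fin 3) : AkmAlgebra p k m :=
  (woronowiczPresentation (akmArray p k m)).generator (i, j)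

end Woronowicz

/-! ### Rotation algebras -/

section Rotation

open FreeStarAlgebra

/-- The relations of the rotation algebra `A_θ`: the generators `v 0` and `v 1` are unitary, and
`v 0 * v 1 = exp (2πiθ) * v 1 * v 0`. -/
inductive RotationRel (θ : ℝ) : FreeStarAlgebra (Fin 2) → Prop
  | star_mul (i : Fin 2) : RotationRel θ (star (gen i) * gen i - 1)
  | mul_star (i : Fin 2) : RotationRel θ (gen i * star (gen i) - 1)
  | comm : RotationRel θ
      (gen 0 * gen 1 - Complex.exp (2 * Real.pi * Complex.I * θ) • (gen 1 * gen 0))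

/-- The presentation of the rotation algebra `A_θ`. -/
def rotationPresentation (θ : ℝ) : CStarPresentation (Fin 2) where
  rel := {r | RotationRel θ r}
  bounded x := by
    refine ⟨1, fun p hp => ?_⟩
    have h : p.coeHom (star (gen x) * gen x - 1) = 0 := by
      rw [← norm_eq_zero]
      exact (p.norm_coe _).trans (hp _ (RotationRel.star_mul x))
    rw [map_sub, map_one, sub_eq_zero, map_mul, map_star] at h
    have h1 := norm_le_one_of_sum_star_mul_self (fun _ : Unit => p.coeHom (gen x)) (by simpa) ()
    exact (p.norm_coe _).ge.trans h1

/-- The rotation algebra (noncommutative torus) `A_θ`. -/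
abbrev RotationAlgebra (θ : ℝ) : Type := (rotationPresentation θ).UniversalAlgebra

/-- The first canonical unitary of `A_θ`. -/
def rotV1 (θ : ℝ) : RotationAlgebra θ := (rotationPresentation θ).generator 0

/-- The second canonical unitary of `A_θ`. -/
def rotV2 (θ : ℝ) : RotationAlgebra θ := (rotationPresentation θ).generator 1

end Rotation

/-! ### Representations -/

section Representations

variable {H : Type*} [NormedAddCommGroup H] [InnerProductSpace ℂ H] [CompleteSpace H]

/-- A representation of a unital C⋆-algebra on a Hilbert space is irreducible if the space is not
zero and there are no closed invariant subspaces besides zero and the whole space. -/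
def IsIrreducibleRep {A : Type*} [CStarAlgebra A] (π : A →⋆ₐ[ℂ] (H →L[ℂ] H)) : Prop :=
  Nontrivial H ∧ ∀ K : Submodule ℂ H, IsClosed (K : Set H) →
    (∀ a, ∀ x ∈ K, π a x ∈ K) → K = ⊥ ∨ K = ⊤

/-- The representation `π` is given by `u₁₁ ↦ z₁`, `u₂₂ ↦ z₂`, `u₃₃ ↦ z̄₁ z̄₂`, and `uᵢⱼ ↦ 0` for
`i ≠ j`. -/
def IsDiagonalRep {p : ℂ} {k m : ℕ} (π : AkmAlgebra p k m →⋆ₐ[ℂ] (H →L[ℂ] H)) (z₁ z₂ : ℂ) :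
    Prop :=
  π (akmU p k m 0 0) = z₁ • 1 ∧ π (akmU p k m 1 1) = z₂ • 1 ∧
    π (akmU p k m 2 2) = (star z₁ * star z₂) • 1 ∧
    ∀ i j, i ≠ j → π (akmU p k m i j) = 0

/-- The representation `π` is supported on the permutation `(231)` and is given there by the
representation `ρ` of a rotation algebra: `u₁₂ ↦ ρ (v₁)`, `u₂₃ ↦ ρ (v₂)`, `u₃₁ ↦ ζ⁻ᵐ ρ (v₂* v₁*)`,
and the other coefficients are sent to `0`. -/
def IsRep231 {p : ℂ} {k m : ℕ} {θ : ℝ} (π : AkmAlgebra p k m →⋆ₐ[ℂ] (H →L[ℂ] H))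
    (ρ : RotationAlgebra θ →⋆ₐ[ℂ] (H →L[ℂ] H)) : Prop :=
  π (akmU p k m 0 1) = ρ (rotV1 θ) ∧ π (akmU p k m 1 2) = ρ (rotV2 θ) ∧
    π (akmU p k m 2 0) = (zeta3 ^ m)⁻¹ • ρ (star (rotV2 θ) * star (rotV1 θ)) ∧
    ∀ i j, (i, j) ≠ (0, 1) → (i, j) ≠ (1, 2) → (i, j) ≠ (2, 0) → π (akmU p k m i j) = 0

/-- The representation `π` is supported on the permutation `(312)` and is given there by the
representation `ρ` of a rotation algebra: `u₁₃ ↦ ρ (v₁)`, `u₂₁ ↦ ρ (v₂)`, `u₃₂ ↦ ζᵐ ρ (v₂* v₁*)`,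
and the other coefficients are sent to `0`. -/
def IsRep312 {p : ℂ} {k m : ℕ} {θ : ℝ} (π : AkmAlgebra p k m →⋆ₐ[ℂ] (H →L[ℂ] H))
    (ρ : RotationAlgebra θ →⋆ₐ[ℂ] (H →L[ℂ] H)) : Prop :=
  π (akmU p k m 0 2) = ρ (rotV1 θ) ∧ π (akmU p k m 1 0) = ρ (rotV2 θ) ∧
    π (akmU p k m 2 1) = zeta3 ^ m • ρ (star (rotV2 θ) * star (rotV1 θ)) ∧
    ∀ i j, (i, j) ≠ (0, 2) → (i, j) ≠ (1, 0) → (i, j) ≠ (2, 1) → π (akmU p k m i j) = 0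

end Representations

end

/-! The determinant relation says that the array `E` is invariant under `u ⊗ u ⊗ u`. Cancelling one
factor by unitarity turns it into an intertwiner `L` from the entrywise adjoint `ū` to `u ⊗ u`.
Cancelling a second factor and taking adjoints shows that the adjoint of the cyclic rotation `R` of
`E` intertwines `u ⊗ u` with `ū`. The coefficients of `E` have modulus `1` or `|p|`, and both `L`
and `R` are multiples of isometries. Since `u ⊗ u` is unitary, so is `ū`, and then `R` itself is an
intertwiner of the same kind as `L` (`square_mul_scalar_rotate`).

Now `E` is a sum of an even part, supported on cyclic permutations, and an odd part, supported on
transpositions. Rotation multiplies them by `ζ^m` and `ζ^(-k)`. These differ exactly because `3`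
does not divide `k + m`, so a linear combination of `L` and `R` isolates each part
(`square_mul_evenArray_oddArray`). Read entrywise, the two separate intertwiners and their adjoints
say that `u b i * u c j = 0` unless `b - i = c - j`, and that each adjoint `star (u a d)` is a
scalar multiple of a product of two entries of the same diagonal (`mul_eq_zero_and_star_eq`).

In an irreducible representation the common kernel of all entries off one diagonal `i = b + t` is
therefore invariant. If the diagonal has a nonzero entry, this kernel contains the range of that
entry, so it is the whole space and `u` is a monomial matrix (`exists_shift`). Its three entries are
unitaries; the third is determined by the first two, which commute up to the scalar `1`, `ζ^(k-m)`
or `ζ^(m-k)` for `t = 0, 1, 2`. For `t = 0` Schur's lemma makes them scalar. For the other shifts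
they are the generators of a rotation algebra. Conversely, every such pair satisfies the relations,
and irreducibility carries over because the images of the generators of either algebra lie in the
range of the other representation. -/

noncomputable section

/-! ### Representations of universal C⋆-algebras -/

namespace CStarPresentation

variable {X : Type} (P : CStarPresentation X)

/-- A closed set of elements of a universal C⋆-algebra which contains the scalars, the generators
and their adjoints, and is closed under sums and products, is everything. -/
theorem universal_induction {S : P.UniversalAlgebra → Prop} (hS : IsClosed {a | S a})
    (hc : ∀ c : ℂ, S (algebraMap ℂ _ c)) (hg : ∀ x, S (P.generator x))
    (hs : ∀ x, S (star (P.generator x))) (ha : ∀ a b, S a → S b → S (a + b))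
    (hm : ∀ a b, S a → S b → S (a * b)) (a : P.UniversalAlgebra) : S a := by
  refine P.denseRange_toUniversal.induction_on (p := S) a hS fun f => ?_
  refine FreeStarAlgebra.induction (P := fun f => S (P.toUniversal f)) ?_ ?_ ?_ ?_ f
  · intro c
    rw [AlgHomClass.commutes]
    exact hc c
  · intro x b
    cases b
    · exact hg x
    · rw [← Bool.not_false, ← FreeStarAlgebra.star_letter, map_star]
      exact hs x
  · intro a b h1 h2
    rw [map_add]
    exact ha _ _ h1 h2
  · intro a b h1 h2
    rw [map_mul]
    exact hm _ _ h1 h2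

variable {P}

theorem continuous_hom {B : Type*} [CStarAlgebra B] (π : P.UniversalAlgebra →⋆ₐ[ℂ] B) :
    Continuous π :=
  AddMonoidHomClass.continuous_of_bound π 1 fun a =>
    (NonUnitalStarAlgHom.norm_apply_le π a).trans (one_mul _).ge

/-- The images of the generators under a `*`-homomorphism satisfy the relations. -/
theorem eval_generator_eq_zero {B : Type*} [CStarAlgebra B] (π : P.UniversalAlgebra →⋆ₐ[ℂ] B)
    {r : FreeStarAlgebra X} (hr : r ∈ P.rel) :
    FreeStarAlgebra.eval (fun x => π (P.generator x)) r = 0 := by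
  have h0 : π (P.toUniversal r) = 0 := by rw [P.toUniversal_eq_zero hr, map_zero]
  rw [← h0]
  refine FreeStarAlgebra.induction (P := fun a => FreeStarAlgebra.eval
    (fun x => π (P.generator x)) a = π (P.toUniversal a)) ?_ ?_ ?_ ?_ r
  · intro c
    simp only [AlgHomClass.commutes]
  · intro x b
    cases b
    · exact FreeStarAlgebra.eval_gen _ x
    · rw [← Bool.not_false, ← FreeStarAlgebra.star_letter, map_star, map_star, map_star]
      exact congrArg star (FreeStarAlgebra.eval_gen _ x)
  · intro a b ha hb; rw [map_add, map_add, map_add, ha, hb]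
  · intro a b ha hb; rw [map_mul, map_mul, map_mul, ha, hb]

theorem commute_hom {B : Type*} [CStarAlgebra B] (π : P.UniversalAlgebra →⋆ₐ[ℂ] B) (T : B)
    (hg : ∀ x, Commute T (π (P.generator x))) (hs : ∀ x, Commute T (star (π (P.generator x))))
    (a : P.UniversalAlgebra) : Commute T (π a) := by
  refine P.universal_induction (S := fun a => Commute T (π a)) ?_ ?_ hg ?_ ?_ ?_ a
  · have := continuous_hom π
    exact isClosed_eq (by fun_prop) (by fun_prop)
  · intro c
    rw [AlgHomClass.commutes]
    exact (Algebra.commutes c T).symm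
  · intro x
    rw [map_star]
    exact hs x
  · intro a b h1 h2
    rw [map_add]
    exact h1.add_right h2
  · intro a b h1 h2
    rw [map_mul]
    exact h1.mul_right h2

variable {H : Type*} [NormedAddCommGroup H] [InnerProductSpace ℂ H] [CompleteSpace H]

/-- Invariance under the adjoints is a separate hypothesis, because a subspace invariant under an
operator need not be invariant under its adjoint. Closedness of `K` lets invariance pass to limits.
-/
theorem invariant_of_generators (π : P.UniversalAlgebra →⋆ₐ[ℂ] (H →L[ℂ] H)) {K : Submodule ℂ H}
    (hK : IsClosed (K : Set H)) (hg : ∀ x, ∀ h ∈ K, π (P.generator x) h ∈ K)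
    (hs : ∀ x, ∀ h ∈ K, star (π (P.generator x)) h ∈ K) (a : P.UniversalAlgebra) :
    ∀ h ∈ K, π a h ∈ K := by
  refine P.universal_induction (S := fun a => ∀ h ∈ K, π a h ∈ K) ?_ ?_ hg ?_ ?_ ?_ a
  · have := continuous_hom π
    simp only [Set.ofPred_forall]
    exact isClosed_iInter fun h => isClosed_iInter fun _ => hK.preimage (by fun_prop)
  · intro c h hh
    rw [AlgHomClass.commutes]
    exact K.smul_mem c hh
  · intro x h hh
    rw [map_star]
    exact hs x h hh
  · intro a b h1 h2 h hh
    rw [map_add]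
    exact K.add_mem (h1 h hh) (h2 h hh)
  · intro a b h1 h2 h hh
    rw [map_mul]
    exact h1 _ (h2 h hh)

end CStarPresentation

/-! ### Irreducibility, Schur's lemma and dimension one -/

namespace IsIrreducibleRep

variable {H : Type*} [NormedAddCommGroup H] [InnerProductSpace ℂ H] [CompleteSpace H]

/-- An operator annihilated from the left by a nonzero intertwiner of an irreducible representation
is zero. -/
theorem eq_zero_of_mul_eq_zero {A : Type*} [CStarAlgebra A] {π : A →⋆ₐ[ℂ] (H →L[ℂ] H)}
    (hπ : IsIrreducibleRep π) {S T : H →L[ℂ] H} (hT : ∀ a, Commute T (π a)) (h : T * S = 0)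
    (hT0 : T ≠ 0) : S = 0 := by
  -- The kernel of an intertwiner is closed and invariant, and here it contains the range of `S`.
  rcases hπ.2 (LinearMap.ker (T : H →ₗ[ℂ] H)) T.isClosed_ker (fun a x hx => by
    have h1 : T (π a x) = π a (T x) := DFunLike.congr_fun (hT a) x
    have h2 : T x = 0 := hx
    change T (π a x) = 0
    rw [h1, h2, map_zero]) with h1 | h1
  · ext x
    have h2 : S x ∈ LinearMap.ker (T : H →ₗ[ℂ] H) := DFunLike.congr_fun h x
    rw [h1] at h2
    exact h2
  · refine absurd ?_ hT0
    ext x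
    have h2 : x ∈ LinearMap.ker (T : H →ₗ[ℂ] H) := h1 ▸ Submodule.mem_top
    exact h2

/-- Schur's lemma for normal intertwiners. -/
theorem exists_eq_smul_one {A : Type*} [CStarAlgebra A] {π : A →⋆ₐ[ℂ] (H →L[ℂ] H)}
    (hπ : IsIrreducibleRep π) {T : H →L[ℂ] H} [IsStarNormal T] (hT : ∀ a, Commute T (π a))
    (hT' : ∀ a, Commute (star T) (π a)) : ∃ c : ℂ, T = c • 1 := by
  have := hπ.1
  obtain ⟨x, hx⟩ := spectrum.nonempty T
  refine ⟨x, ?_⟩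
  by_cases hxy : ∀ y ∈ spectrum ℂ T, y = x
  · have h1 : cfc (fun z : ℂ => z) T = cfc (fun _ : ℂ => x) T := cfc_congr hxy
    rwa [cfc_id' ℂ T, cfc_const x T, Algebra.algebraMap_eq_smul_one] at h1
  · push Not at hxy
    obtain ⟨y, hy, hyx⟩ := hxy
    exfalso
    -- Tent functions of radius half the distance of two spectral points: their supports meet in no
    -- interior point, so the product vanishes, while each is nonzero at its own centre. The
    -- functional calculus then gives two nonzero operators with product zero, one of them an
    -- intertwiner.
    set f : ℂ → ℂ → ℂ := fun w z => ((max 0 (dist y x / 2 - dist z w) : ℝ) : ℂ) with hf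
    have hcont : ∀ w, Continuous (f w) := fun w => by
      simp only [hf]
      fun_prop
    have hne : ∀ w ∈ spectrum ℂ T, cfc (f w) T ≠ 0 := by
      intro w hw h0
      rw [← cfc_zero ℂ T] at h0
      have h1 : f w w = 0 := (cfc_eq_cfc_iff_eqOn (R := ℂ) (a := T) (hf := (hcont w).continuousOn)
        (hg := continuousOn_const)).1 h0 hw
      have h2 : 0 < dist y x := dist_pos.2 hyx
      simp only [hf, dist_self, sub_zero, Complex.ofReal_eq_zero] at h1
      linarith [le_max_right 0 (dist y x / 2)]
    refine hne x hx (hπ.eq_zero_of_mul_eq_zero (fun a => (hT a).cfc (hT' a) (f y)) ?_ (hne y hy))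
    rw [← cfc_mul _ _ T (hcont y).continuousOn (hcont x).continuousOn, ← cfc_zero ℂ T]
    refine cfc_congr fun z _ => ?_
    have h3 := dist_triangle_left y x z
    simp only [hf, ← Complex.ofReal_mul, Pi.zero_apply, Complex.ofReal_eq_zero, mul_eq_zero]
    rcases le_total (dist y x / 2) (dist z y) with h | h
    · exact Or.inl (max_eq_left (by linarith))
    · exact Or.inr (max_eq_left (by linarith))

/-- An irreducible representation which sends the generators to scalars is one-dimensional. -/
theorem finrank_eq_one {X : Type} {P : CStarPresentation X}
    {π : P.UniversalAlgebra →⋆ₐ[ℂ] (H →L[ℂ] H)} (hπ : IsIrreducibleRep π)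
    (h : ∀ x, ∃ c : ℂ, π (P.generator x) = c • 1) : Module.finrank ℂ H = 1 := by
  have := hπ.1
  obtain ⟨x, hx⟩ := exists_ne (0 : H)
  refine finrank_eq_one_iff'.2 ⟨x, hx, fun w => ?_⟩
  -- If all generators act by scalars, the line through any nonzero vector is invariant.
  have hK : IsClosed ((ℂ ∙ x : Submodule ℂ H) : Set H) := Submodule.closed_of_finiteDimensional _
  rcases hπ.2 _ hK (CStarPresentation.invariant_of_generators π hK
    (fun a y hy => by
      obtain ⟨c, hc⟩ := h a
      rw [hc]
      exact Submodule.smul_mem _ c hy)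
    (fun a y hy => by
      obtain ⟨c, hc⟩ := h a
      rw [hc, star_smul, star_one]
      exact Submodule.smul_mem _ (star c) hy)) with h1 | h1
  · exact absurd (Submodule.span_singleton_eq_bot.1 h1) hx
  · exact Submodule.mem_span_singleton.1 (h1 ▸ Submodule.mem_top)

theorem of_finrank_eq_one {A : Type*} [CStarAlgebra A] (π : A →⋆ₐ[ℂ] (H →L[ℂ] H))
    (h : Module.finrank ℂ H = 1) : IsIrreducibleRep π := by
  have h1 : IsSimpleOrder (Submodule ℂ H) := is_simple_module_of_finrank_eq_one h
  exact ⟨Module.nontrivial_of_finrank_pos (R := ℂ) (by omega), fun K _ _ => eq_bot_or_eq_top K⟩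

/-- Irreducibility passes to representations whose range contains the images of the generators. -/
theorem of_generators {X : Type} {P : CStarPresentation X} {A : Type*} [CStarAlgebra A]
    {ρ : P.UniversalAlgebra →⋆ₐ[ℂ] (H →L[ℂ] H)} (hρ : IsIrreducibleRep ρ)
    (π : A →⋆ₐ[ℂ] (H →L[ℂ] H)) (h : ∀ x, ∃ a, π a = ρ (P.generator x)) :
    IsIrreducibleRep π := by
  refine ⟨hρ.1, fun K hK hinv => hρ.2 K hK ?_⟩
  refine CStarPresentation.invariant_of_generators ρ hK (fun x => ?_) (fun x => ?_)
  · obtain ⟨a, ha⟩ := h x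
    exact ha ▸ hinv a
  · obtain ⟨a, ha⟩ := h x
    rw [← ha, ← map_star]
    exact hinv (star a)

end IsIrreducibleRep

/-! ### Families which satisfy the Woronowicz relations -/

theorem FreeStarAlgebra.eval_star_gen {X : Type} {B : Type*} [Ring B] [StarRing B] [Algebra ℂ B]
    [StarModule ℂ B] (v : X → B) (x : X) :
    FreeStarAlgebra.eval v (star (FreeStarAlgebra.gen x)) = star (v x) := by
  rw [map_star, eval_gen]

/-- The unitarity and twisted determinant relations for a family of elements of a `*`-algebra. -/
structure IsWoronowiczFamily {B : Type*} [Ring B] [StarRing B] [Algebra ℂ B]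
    (E : Fin 3 → Fin 3 → Fin 3 → ℂ) (u : Fin 3 → Fin 3 → B) : Prop where
  mul_star : ∀ j k, ∑ s, u j s * star (u k s) = if j = k then 1 else 0
  star_mul : ∀ j k, ∑ s, star (u s j) * u s k = if j = k then 1 else 0
  det : ∀ a b c, ∑ i, ∑ j, ∑ l, E i j l • (u a i * u b j * u c l) = E a b c • (1 : B)

/-- Both directions are used: one feeds concrete matrices into the universal property, the other
extracts matrix identities from a given representation. -/
theorem woronowicz_eval_eq_zero_iff {B : Type*} [CStarAlgebra B]
    (E : Fin 3 → Fin 3 → Fin 3 → ℂ) (v : Fin 3 × Fin 3 → B) :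
    (∀ r ∈ (woronowiczPresentation E).rel, FreeStarAlgebra.eval v r = 0) ↔
      IsWoronowiczFamily E fun i j => v (i, j) := by
  constructor
  · intro h
    refine ⟨fun j k => ?_, fun j k => ?_, fun a b c => ?_⟩
    · have h1 := h _ (WoronowiczRel.mul_star j k)
      simpa [uFree, FreeStarAlgebra.eval_star_gen, sub_eq_zero,
        apply_ite (FreeStarAlgebra.eval v)] using h1
    · have h1 := h _ (WoronowiczRel.star_mul j k)
      simpa [uFree, FreeStarAlgebra.eval_star_gen, sub_eq_zero,
        apply_ite (FreeStarAlgebra.eval v)] using h1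
    · have h1 := h _ (WoronowiczRel.det a b c)
      simpa only [uFree, sub_eq_zero, map_sub, map_sum, map_smul, map_mul, map_one,
        FreeStarAlgebra.eval_gen] using h1
  · rintro h r (⟨j, k⟩ | ⟨j, k⟩ | ⟨a, b, c⟩)
    · have h1 := h.mul_star j k
      simpa [uFree, FreeStarAlgebra.eval_star_gen, sub_eq_zero,
        apply_ite (FreeStarAlgebra.eval v)] using h1
    · have h1 := h.star_mul j k
      simpa [uFree, FreeStarAlgebra.eval_star_gen, sub_eq_zero,
        apply_ite (FreeStarAlgebra.eval v)] using h1
    · have h1 := h.det a b c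
      simpa only [uFree, sub_eq_zero, map_sub, map_sum, map_smul, map_mul, map_one,
        FreeStarAlgebra.eval_gen] using h1

theorem existsUnique_akm_hom {B : Type*} [CStarAlgebra B] {p : ℂ} {k m : ℕ}
    {u : Fin 3 → Fin 3 → B} (hu : IsWoronowiczFamily (akmArray p k m) u) :
    ∃! π : AkmAlgebra p k m →⋆ₐ[ℂ] B, ∀ i j, π (akmU p k m i j) = u i j := by
  have h := (woronowiczPresentation (akmArray p k m)).existsUnique_hom (fun x => u x.1 x.2)
    ((woronowicz_eval_eq_zero_iff _ _).2 hu)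
  simp only [Prod.forall] at h
  exact h

theorem isWoronowiczFamily_akmU {B : Type*} [CStarAlgebra B] {p : ℂ} {k m : ℕ}
    (π : AkmAlgebra p k m →⋆ₐ[ℂ] B) :
    IsWoronowiczFamily (akmArray p k m) fun i j => π (akmU p k m i j) := by
  exact (woronowicz_eval_eq_zero_iff _ fun x => π (akmU p k m x.1 x.2)).1 fun _ hr =>
    CStarPresentation.eval_generator_eq_zero π hr

/-- The relations of the rotation algebra, for two elements of a `*`-algebra. -/
structure IsRotationPair {B : Type*} [Ring B] [StarRing B] [Algebra ℂ B] (q : ℂ) (v w : B) :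
    Prop where
  left : v ∈ unitary B
  right : w ∈ unitary B
  comm : v * w = q • (w * v)

theorem existsUnique_rotation_hom {B : Type*} [CStarAlgebra B] {θ : ℝ} {v w : B}
    (h : IsRotationPair (Complex.exp (2 * Real.pi * Complex.I * θ)) v w) :
    ∃! ρ : RotationAlgebra θ →⋆ₐ[ℂ] B, ρ (rotV1 θ) = v ∧ ρ (rotV2 θ) = w := by
  have h1 := (rotationPresentation θ).existsUnique_hom ![v, w] ?_
  · simp only [Fin.forall_fin_two] at h1
    exact h1
  · rintro r (i | i | _)
    · fin_cases i
      · simpa [sub_eq_zero, FreeStarAlgebra.eval_star_gen] using h.left.1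
      · simpa [sub_eq_zero, FreeStarAlgebra.eval_star_gen] using h.right.1
    · fin_cases i
      · simpa [sub_eq_zero, FreeStarAlgebra.eval_star_gen] using h.left.2
      · simpa [sub_eq_zero, FreeStarAlgebra.eval_star_gen] using h.right.2
    · simpa [sub_eq_zero, FreeStarAlgebra.eval_star_gen] using h.comm

theorem isRotationPair_rotV {B : Type*} [CStarAlgebra B] {θ : ℝ}
    (ρ : RotationAlgebra θ →⋆ₐ[ℂ] B) :
    IsRotationPair (Complex.exp (2 * Real.pi * Complex.I * θ)) (ρ (rotV1 θ)) (ρ (rotV2 θ)) := by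
  have h : ∀ r, RotationRel θ r → _ := fun r hr =>
    CStarPresentation.eval_generator_eq_zero (P := rotationPresentation θ) ρ hr
  have h1 := fun i => h _ (RotationRel.star_mul i)
  have h2 := fun i => h _ (RotationRel.mul_star i)
  have h3 := h _ RotationRel.comm
  simp only [map_sub, map_mul, map_star, map_smul, map_one, FreeStarAlgebra.eval_gen,
    sub_eq_zero] at h1 h2 h3
  exact ⟨⟨h1 0, h2 0⟩, ⟨h1 1, h2 1⟩, h3⟩

/-! ### Intertwiners of the fundamental corepresentation -/

namespace IsWoronowiczFamily

open Matrix

/-- A scalar array, regarded as a map of `ℂ³` into `ℂ³ ⊗ ℂ³`. -/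
def scalar (B : Type*) [Ring B] [Algebra ℂ B] (F : Fin 3 → Fin 3 → Fin 3 → ℂ) :
    Matrix (Fin 3 × Fin 3) (Fin 3) B :=
  of fun x d => algebraMap ℂ B (F d x.1 x.2)

theorem scalar_apply {B : Type*} [Ring B] [Algebra ℂ B] (F : Fin 3 → Fin 3 → Fin 3 → ℂ)
    (x : Fin 3 × Fin 3) (d : Fin 3) : scalar B F x d = algebraMap ℂ B (F d x.1 x.2) := rfl

variable {B : Type*} [Ring B] [StarRing B] [Algebra ℂ B]

/-- The tensor square of the matrix `u`. -/
def square (u : Fin 3 → Fin 3 → B) : Matrix (Fin 3 × Fin 3) (Fin 3 × Fin 3) B :=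
  of fun x y => u x.1 y.1 * u x.2 y.2

/-- The entrywise adjoint of the matrix `u`. -/
def conj (u : Fin 3 → Fin 3 → B) : Matrix (Fin 3) (Fin 3) B := of fun a d => star (u a d)

variable {E : Fin 3 → Fin 3 → Fin 3 → ℂ} {u : Fin 3 → Fin 3 → B}

/-- The adjoint reverses products, so the second tensor factors are adjacent and their sum must be
collapsed first. In `conjTranspose_mul_square` it is the first factors that are adjacent. -/
theorem square_mul_conjTranspose (h : IsWoronowiczFamily E u) :
    square u * (square u)ᴴ = 1 := by
  ext ⟨b, c⟩ ⟨b', c'⟩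
  have h1 : ∀ i, ∑ j, u b i * u c j * star (u b' i * u c' j) =
      u b i * (if c = c' then 1 else 0) * star (u b' i) := fun i => by
    rw [← h.mul_star, Finset.mul_sum, Finset.sum_mul]
    exact Finset.sum_congr rfl fun j _ => by simp only [StarMul.star_mul, mul_assoc]
  simp only [mul_apply, square, of_apply, conjTranspose_apply, Fintype.sum_prod_type, h1,
    one_apply, Prod.mk.injEq]
  by_cases hc : c = c' <;> simp [hc, h.mul_star]

theorem conjTranspose_mul_square (h : IsWoronowiczFamily E u) :
    (square u)ᴴ * square u = 1 := by
  ext ⟨i, j⟩ ⟨i', j'⟩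
  have h1 : ∀ c, ∑ b, star (u b i * u c j) * (u b i' * u c j') =
      star (u c j) * (if i = i' then 1 else 0) * u c j' := fun c => by
    rw [← h.star_mul, Finset.mul_sum, Finset.sum_mul]
    exact Finset.sum_congr rfl fun b _ => by simp only [StarMul.star_mul, mul_assoc]
  simp only [mul_apply, square, of_apply, conjTranspose_apply, Fintype.sum_prod_type_right, h1,
    one_apply, Prod.mk.injEq]
  by_cases hi : i = i' <;> simp [hi, h.star_mul]

/-- Multiply the determinant relation on the left by `star (u a d)` and sum over `a`: unitarity
cancels the first of the three factors. -/
theorem sum_smul_mul_left (h : IsWoronowiczFamily E u) (d b c : Fin 3) :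
    ∑ i, ∑ j, E d i j • (u b i * u c j) = ∑ a, E a b c • star (u a d) := by
  have h1 : ∀ a, E a b c • star (u a d) =
      ∑ i, star (u a d) * u a i * ∑ j, ∑ l, E i j l • (u b j * u c l) := fun a => by
    rw [← mul_one (star (u a d)), ← mul_smul_comm, ← h.det, Finset.mul_sum]
    refine Finset.sum_congr rfl fun i _ => ?_
    simp only [Finset.mul_sum, mul_smul_comm, mul_assoc, mul_one]
  symm
  simp only [h1]
  rw [Finset.sum_comm]
  simp only [← Finset.sum_mul, h.star_mul, ite_mul, one_mul, zero_mul, Finset.sum_ite_eq,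
    Finset.mem_univ, if_true]

/-- The same cancellation, applied to `sum_smul_mul_left`, removes a second factor and leaves only
one on the right. -/
theorem sum_smul_star_mul_star (h : IsWoronowiczFamily E u) (c i j : Fin 3) :
    ∑ a, ∑ b, E a b c • (star (u b j) * star (u a i)) = ∑ l, E i j l • u c l := by
  have h1 : ∀ b, ∑ a, E a b c • (star (u b j) * star (u a i)) =
      ∑ j', star (u b j) * u b j' * ∑ l, E i j' l • u c l := fun b => by
    simp only [← mul_smul_comm]
    rw [← Finset.mul_sum, ← h.sum_smul_mul_left, Finset.mul_sum]
    refine Finset.sum_congr rfl fun j' _ => ?_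
    simp only [Finset.mul_sum, mul_smul_comm, mul_assoc]
  rw [Finset.sum_comm]
  simp only [h1]
  rw [Finset.sum_comm]
  simp only [← Finset.sum_mul, h.star_mul, ite_mul, one_mul, zero_mul, Finset.sum_ite_eq,
    Finset.mem_univ, if_true]

theorem square_mul_scalar_iff {F : Fin 3 → Fin 3 → Fin 3 → ℂ} :
    square u * scalar B F = scalar B F * conj u ↔ ∀ d b c,
      ∑ i, ∑ j, F d i j • (u b i * u c j) = ∑ a, F a b c • star (u a d) := by
  rw [← Matrix.ext_iff]
  simp only [mul_apply, square, scalar, conj, of_apply, Fintype.sum_prod_type, Prod.forall,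
    ← Algebra.commutes (F _ _ _), ← Algebra.smul_def]
  exact ⟨fun h d b c => h b c d, fun h b c d => h d b c⟩

theorem square_mul_scalar (h : IsWoronowiczFamily E u) :
    square u * scalar B E = scalar B E * conj u :=
  square_mul_scalar_iff.2 h.sum_smul_mul_left

/-- The adjoint of an intertwiner is an intertwiner. -/
theorem conjTranspose_intertwines (h : IsWoronowiczFamily E u) (h1 : conj u * (conj u)ᴴ = 1)
    {M : Matrix (Fin 3 × Fin 3) (Fin 3) B} (hM : square u * M = M * conj u) :
    Mᴴ * square u = conj u * Mᴴ := by
  have h2 := congrArg conjTranspose hM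
  rw [conjTranspose_mul, conjTranspose_mul] at h2
  calc Mᴴ * square u = conj u * ((conj u)ᴴ * Mᴴ) * square u := by
        rw [← Matrix.mul_assoc, h1, Matrix.one_mul]
    _ = conj u * Mᴴ := by
        rw [← h2, Matrix.mul_assoc, Matrix.mul_assoc, h.conjTranspose_mul_square, Matrix.mul_one]

variable [StarModule ℂ B]

theorem scalar_conjTranspose_apply (F : Fin 3 → Fin 3 → Fin 3 → ℂ) (d : Fin 3)
    (x : Fin 3 × Fin 3) : (scalar B F)ᴴ d x = algebraMap ℂ B (star (F d x.1 x.2)) := by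
  rw [conjTranspose_apply, scalar, of_apply, ← algebraMap_star_comm]

theorem scalar_conjTranspose_mul_square_iff {F : Fin 3 → Fin 3 → Fin 3 → ℂ} :
    (scalar B F)ᴴ * square u = conj u * (scalar B F)ᴴ ↔ ∀ d i j,
      ∑ a, ∑ b, star (F d a b) • (u a i * u b j) = ∑ l, star (F l i j) • star (u d l) := by
  rw [← Matrix.ext_iff]
  simp only [mul_apply, square, scalar_conjTranspose_apply, conj, of_apply, Fintype.sum_prod_type,
    Prod.forall, ← Algebra.commutes (star (F _ _ _)), ← Algebra.smul_def]

/-- This is the adjoint of the twice contracted determinant relation, which is why the rotated array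
appears. -/
theorem scalar_conjTranspose_mul_square (h : IsWoronowiczFamily E u) :
    (scalar B fun d i j => E i j d)ᴴ * square u =
      conj u * (scalar B fun d i j => E i j d)ᴴ := by
  refine scalar_conjTranspose_mul_square_iff.2 fun d i j => ?_
  have h1 := congrArg star (h.sum_smul_star_mul_star d i j)
  simpa only [star_sum, star_smul, StarMul.star_mul, star_star] using h1

/-- Orthogonal slices of equal norm make the array a multiple of an isometry, which can be cancelled
against its adjoint. -/
theorem scalar_conjTranspose_mul_scalar {F : Fin 3 → Fin 3 → Fin 3 → ℂ} {c : ℂ}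
    (hF : ∀ d d', ∑ i, ∑ j, star (F d i j) * F d' i j = if d = d' then c else 0) :
    (scalar B F)ᴴ * scalar B F = c • 1 := by
  ext d d'
  simp only [mul_apply, scalar_conjTranspose_apply, scalar_apply, Fintype.sum_prod_type,
    ← map_mul, ← map_sum, hF, Matrix.smul_apply, one_apply]
  split_ifs <;> simp [Algebra.algebraMap_eq_smul_one]

/-- If both ways of contracting `E` with itself are scalar, then the entrywise adjoint of `u`
is unitary, and the rotation of `E` is an intertwiner, too. -/
theorem square_mul_scalar_rotate (h : IsWoronowiczFamily E u) {c c' : ℂ} (hc : c ≠ 0)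
    (hc' : c' ≠ 0)
    (hE : ∀ d d', ∑ i, ∑ j, star (E d i j) * E d' i j = if d = d' then c else 0)
    (hE' : ∀ d d', ∑ i, ∑ j, star (E i j d) * E i j d' = if d = d' then c' else 0) :
    conj u * (conj u)ᴴ = 1 ∧
      square u * (scalar B fun d i j => E i j d) = (scalar B fun d i j => E i j d) * conj u := by
  set L := scalar B E
  set R := scalar B fun d i j => E i j d
  have hL : Lᴴ * L = c • 1 := scalar_conjTranspose_mul_scalar hE
  have hR : Rᴴ * R = c' • 1 := scalar_conjTranspose_mul_scalar hE'
  have hu := h.square_mul_conjTranspose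
  have hu' := h.conjTranspose_mul_square
  have h1 : square u * L = L * conj u := h.square_mul_scalar
  have h2 : Rᴴ * square u = conj u * Rᴴ := h.scalar_conjTranspose_mul_square
  have h1' : Lᴴ * (square u)ᴴ = (conj u)ᴴ * Lᴴ := by
    rw [← conjTranspose_mul, h1, conjTranspose_mul]
  have h2' : (square u)ᴴ * R = R * (conj u)ᴴ := by
    have := congrArg conjTranspose h2
    rwa [conjTranspose_mul, conjTranspose_mul, conjTranspose_conjTranspose] at this
  -- The intertwiner `L` gives one half of unitarity and `R` the other. Over a noncommutative ring,
  -- a one-sided inverse of a square matrix need not be two-sided.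
  have h3 : (conj u)ᴴ * conj u = 1 := by
    have h4 : c • ((conj u)ᴴ * conj u) = c • 1 := by
      calc c • ((conj u)ᴴ * conj u) = (conj u)ᴴ * (Lᴴ * L) * conj u := by
            rw [hL, mul_smul_comm, mul_one, smul_mul_assoc]
        _ = ((conj u)ᴴ * Lᴴ) * (L * conj u) := by simp only [Matrix.mul_assoc]
        _ = Lᴴ * ((square u)ᴴ * square u) * L := by
            rw [← h1, ← h1']; simp only [Matrix.mul_assoc]
        _ = c • 1 := by rw [hu', Matrix.mul_one, hL]
    simpa [smul_smul, hc] using congrArg (c⁻¹ • ·) h4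
  have h3' : conj u * (conj u)ᴴ = 1 := by
    have h4 : c' • (conj u * (conj u)ᴴ) = c' • 1 := by
      calc c' • (conj u * (conj u)ᴴ) = conj u * (Rᴴ * R) * (conj u)ᴴ := by
            rw [hR, mul_smul_comm, mul_one, smul_mul_assoc]
        _ = (conj u * Rᴴ) * (R * (conj u)ᴴ) := by simp only [Matrix.mul_assoc]
        _ = Rᴴ * (square u * (square u)ᴴ) * R := by
            rw [← h2, ← h2']; simp only [Matrix.mul_assoc]
        _ = c' • 1 := by rw [hu, Matrix.mul_one, hR]
    simpa [smul_smul, hc'] using congrArg (c'⁻¹ • ·) h4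
  refine ⟨h3', ?_⟩
  -- Insert `(conj u)ᴴ * conj u = 1` and move `R` across with the adjoint of its relation.
  calc square u * R = square u * (R * (conj u)ᴴ) * conj u := by
        simp only [Matrix.mul_assoc, h3, Matrix.mul_one]
    _ = R * conj u := by rw [← h2', ← Matrix.mul_assoc, hu, Matrix.one_mul]

end IsWoronowiczFamily

/-! ### Separation of the even and the odd part of the array -/

/-- The part of the array supported on the cyclic permutations. -/
def evenArray (x : ℂ) (d i j : Fin 3) : ℂ := if i = d + 1 ∧ j = d + 2 then x ^ (d : ℕ) else 0

/-- The part of the array supported on the transpositions. -/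
def oddArray (y : ℂ) (d i j : Fin 3) : ℂ := if i = d + 2 ∧ j = d + 1 then y ^ (d : ℕ) else 0

theorem zeta3_pow_three : zeta3 ^ 3 = 1 := by
  rw [zeta3, ← Complex.exp_nat_mul, ← Complex.exp_two_pi_mul_I]
  congr 1
  push_cast
  ring

theorem zeta3_pow_pow_three (n : ℕ) : (zeta3 ^ n) ^ 3 = 1 := by
  rw [← pow_mul, mul_comm, pow_mul, zeta3_pow_three, one_pow]

theorem isPrimitiveRoot_zeta3 : IsPrimitiveRoot zeta3 3 := by
  simpa [zeta3] using Complex.isPrimitiveRoot_exp 3 (by norm_num)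

theorem inv_eq_sq_of_pow_three {x : ℂ} (hx : x ^ 3 = 1) : x⁻¹ = x ^ 2 :=
  inv_eq_of_mul_eq_one_right (by rw [← hx]; ring)

theorem conj_eq_inv_of_pow_three {x : ℂ} (hx : x ^ 3 = 1) : star x = x⁻¹ :=
  (Complex.inv_eq_conj (Complex.norm_eq_one_of_pow_eq_one hx (by norm_num))).symm

/-- The inverses in the array fit the pattern `x ^ d` at `d = 2`, since `x⁻¹ = x ^ 2` for a cube
root of unity. -/
theorem akmArray_eq (p : ℂ) (k m : ℕ) (d i j : Fin 3) :
    akmArray p k m d i j = evenArray (zeta3 ^ m) d i j + p * oddArray (zeta3 ^ k) d i j := by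
  have hm := inv_eq_sq_of_pow_three (zeta3_pow_pow_three m)
  have hk := inv_eq_sq_of_pow_three (zeta3_pow_pow_three k)
  fin_cases d <;> fin_cases i <;> fin_cases j <;>
    simp [akmArray, evenArray, oddArray, hm, hk]

/-- The even and the odd part are eigenvectors of cyclic rotation, with eigenvalues `ζ^m` and
`ζ^(-k)`. This is what makes the two parts separable. -/
theorem akmArray_rotate (p : ℂ) (k m : ℕ) (d i j : Fin 3) :
    akmArray p k m i j d = zeta3 ^ m * evenArray (zeta3 ^ m) d i j +
      (zeta3 ^ k)⁻¹ * (p * oddArray (zeta3 ^ k) d i j) := by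
  have hm := zeta3_pow_pow_three m
  have hk := zeta3_pow_pow_three k
  have hm' := inv_eq_sq_of_pow_three hm
  have hk' := inv_eq_sq_of_pow_three hk
  generalize hx : zeta3 ^ m = x at *
  generalize hy : zeta3 ^ k = y at *
  fin_cases d <;> fin_cases i <;> fin_cases j <;>
    simp [akmArray, evenArray, oddArray, hx, hy, hm', hk'] <;> grind

/-- Each slice has two nonzero coefficients, of modulus `1` and `|p|`, and different slices have
disjoint supports. -/
theorem sum_star_akmArray_mul (p : ℂ) (k m : ℕ) (d d' : Fin 3) :
    ∑ i, ∑ j, star (akmArray p k m d i j) * akmArray p k m d' i j =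
      if d = d' then 1 + star p * p else 0 := by
  have hm := zeta3_pow_pow_three m
  have hk := zeta3_pow_pow_three k
  have hm' := conj_eq_inv_of_pow_three hm
  have hk' := conj_eq_inv_of_pow_three hk
  have hm0 : zeta3 ^ m ≠ 0 := fun h => by simp [h] at hm
  have hk0 : zeta3 ^ k ≠ 0 := fun h => by simp [h] at hk
  generalize hx : zeta3 ^ m = x at *
  generalize hy : zeta3 ^ k = y at *
  simp only [Complex.star_def] at hm' hk'
  fin_cases d <;> fin_cases d' <;>
    simp [akmArray, hx, hy, hm', hk', Fin.sum_univ_three] <;> grind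

theorem sum_star_akmArray_rotate_mul (p : ℂ) (k m : ℕ) (d d' : Fin 3) :
    ∑ i, ∑ j, star (akmArray p k m i j d) * akmArray p k m i j d' =
      if d = d' then 1 + star p * p else 0 := by
  have hm := zeta3_pow_pow_three m
  have hk := zeta3_pow_pow_three k
  have hm' := conj_eq_inv_of_pow_three hm
  have hk' := conj_eq_inv_of_pow_three hk
  have hm0 : zeta3 ^ m ≠ 0 := fun h => by simp [h] at hm
  have hk0 : zeta3 ^ k ≠ 0 := fun h => by simp [h] at hk
  generalize hx : zeta3 ^ m = x at *
  generalize hy : zeta3 ^ k = y at *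
  simp only [Complex.star_def] at hm' hk'
  fin_cases d <;> fin_cases d' <;>
    simp [akmArray, hx, hy, hm', hk', Fin.sum_univ_three] <;> grind

/-! ### The separate intertwiners and their entrywise consequences -/

namespace IsWoronowiczFamily

open Matrix

theorem scalar_add_smul {B : Type*} [Ring B] [Algebra ℂ B] (a b : ℂ) (F G : Fin 3 → Fin 3 → Fin 3 → ℂ) :
    scalar B (fun d i j => a * F d i j + b * G d i j) = a • scalar B F + b • scalar B G := by
  ext x d
  simp [scalar_apply, Algebra.smul_def]

variable {B : Type*} [Ring B] [StarRing B] [Algebra ℂ B]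

/-- Two of the indices of a nonzero coefficient are determined by the third, so both sides of the
intertwining identity reduce to at most one term. -/
theorem smul_mul_of_evenArray {u : Fin 3 → Fin 3 → B} {x : ℂ}
    (h : square u * scalar B (evenArray x) = scalar B (evenArray x) * conj u) (b c d : Fin 3) :
    x ^ (d : ℕ) • (u b (d + 1) * u c (d + 2)) =
      if c = b + 1 then x ^ ((b + 2 : Fin 3) : ℕ) • star (u (b + 2) d) else 0 := by
  have h1 := square_mul_scalar_iff.1 h d b c
  have h2 : ∀ a b c : Fin 3, (b = a + 1 ∧ c = a + 2) ↔ (c = b + 1 ∧ a = b + 2) := by decide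
  simpa only [evenArray, h2 _ b c, ite_and, ite_smul, zero_smul, Finset.sum_ite_eq', Finset.mem_univ,
    if_true, Finset.sum_ite_irrel, Finset.sum_const_zero] using h1

theorem smul_mul_of_oddArray {u : Fin 3 → Fin 3 → B} {y : ℂ}
    (h : square u * scalar B (oddArray y) = scalar B (oddArray y) * conj u) (b c d : Fin 3) :
    y ^ (d : ℕ) • (u b (d + 2) * u c (d + 1)) =
      if c = b + 2 then y ^ ((b + 1 : Fin 3) : ℕ) • star (u (b + 1) d) else 0 := by
  have h1 := square_mul_scalar_iff.1 h d b c
  have h2 : ∀ a b c : Fin 3, (b = a + 2 ∧ c = a + 1) ↔ (c = b + 2 ∧ a = b + 1) := by decide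
  simpa only [oddArray, h2 _ b c, ite_and, ite_smul, zero_smul, Finset.sum_ite_eq', Finset.mem_univ,
    if_true, Finset.sum_ite_irrel, Finset.sum_const_zero] using h1

variable [StarModule ℂ B]

variable {p : ℂ} {k m : ℕ} {u : Fin 3 → Fin 3 → B}

/-- If `k + m` is not divisible by three, then the even and the odd part of the array are separately
intertwiners, and so are their adjoints. -/
theorem square_mul_evenArray_oddArray (hp : p ≠ 0) (hkm : ¬ k + m ≡ 0 [MOD 3])
    (h : IsWoronowiczFamily (akmArray p k m) u) :
    conj u * (conj u)ᴴ = 1 ∧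
    square u * scalar B (evenArray (zeta3 ^ m)) = scalar B (evenArray (zeta3 ^ m)) * conj u ∧
      square u * scalar B (oddArray (zeta3 ^ k)) = scalar B (oddArray (zeta3 ^ k)) * conj u := by
  have hc : 1 + star p * p ≠ 0 := by
    rw [Complex.star_def, mul_comm, Complex.mul_conj]
    norm_cast
    have := Complex.normSq_nonneg p
    positivity
  obtain ⟨h2, h3⟩ := h.square_mul_scalar_rotate hc hc (sum_star_akmArray_mul p k m)
    (sum_star_akmArray_rotate_mul p k m)
  have h1 := h.square_mul_scalar
  have hL : akmArray p k m = fun d i j =>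
      1 * evenArray (zeta3 ^ m) d i j + p * oddArray (zeta3 ^ k) d i j := by
    ext d i j
    rw [akmArray_eq, one_mul]
  have hR : (fun d i j => akmArray p k m i j d) = fun d i j =>
      zeta3 ^ m * evenArray (zeta3 ^ m) d i j +
        ((zeta3 ^ k)⁻¹ * p) * oddArray (zeta3 ^ k) d i j := by
    ext d i j
    rw [akmArray_rotate, mul_assoc]
  -- The two eigenvalues of rotation coincide only if `ζ^(k+m) = 1`.
  have hζ : zeta3 ^ m - (zeta3 ^ k)⁻¹ ≠ 0 := by
    intro h0
    refine hkm ((Nat.modEq_zero_iff_dvd).2 ((isPrimitiveRoot_zeta3.pow_eq_one_iff_dvd _).1 ?_))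
    rw [pow_add, sub_eq_zero.1 h0, mul_inv_cancel₀]
    exact pow_ne_zero _ (isPrimitiveRoot_zeta3.ne_zero (by norm_num))
  rw [hR, scalar_add_smul] at h3
  rw [hL, scalar_add_smul] at h1
  generalize scalar B (evenArray (zeta3 ^ m)) = P at *
  generalize scalar B (oddArray (zeta3 ^ k)) = Q at *
  generalize zeta3 ^ m = x at *
  generalize (zeta3 ^ k)⁻¹ = y at *
  simp only [Matrix.mul_add, Matrix.add_mul, Matrix.mul_smul, Matrix.smul_mul, one_smul,
    mul_smul] at h1 h3
  -- Subtracting `y` times the relation for `E` from the one for its rotation kills the odd part and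
  -- leaves `x - y` times the even part.
  have hP : square u * P = P * conj u := by
    have h4 : (x - y) • (square u * P) = (x - y) • (P * conj u) := by
      have h5 := congrArg (y • ·) h1
      simp only [smul_add] at h5
      have h6 := congrArg₂ (· - ·) h3 h5
      simp only [add_sub_add_right_eq_sub] at h6
      rwa [sub_smul, sub_smul]
    simpa [smul_smul, hζ] using congrArg ((x - y)⁻¹ • ·) h4
  refine ⟨h2, hP, ?_⟩
  rw [hP, add_right_inj] at h1
  simpa [smul_smul, hp] using congrArg (p⁻¹ • ·) h1

/-- Entries of `u` whose column index minus row index differ have product zero. -/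
theorem mul_eq_zero_and_star_eq (hp : p ≠ 0) (hkm : ¬ k + m ≡ 0 [MOD 3])
    (h : IsWoronowiczFamily (akmArray p k m) u) :
    (∀ b i c j, b - i ≠ c - j → u b i * u c j = 0) ∧
    (∀ a d : Fin 3, (zeta3 ^ m) ^ (d : ℕ) • (u (a + 1) (d + 1) * u (a + 2) (d + 2)) =
      (zeta3 ^ m) ^ (a : ℕ) • star (u a d)) ∧
    (∀ a d : Fin 3, (zeta3 ^ k) ^ (d : ℕ) • (u (a + 2) (d + 2) * u (a + 1) (d + 1)) =
      (zeta3 ^ k) ^ (a : ℕ) • star (u a d)) := by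
  obtain ⟨h1, hP, hQ⟩ := h.square_mul_evenArray_oddArray hp hkm
  have hP' := h.conjTranspose_intertwines h1 hP
  have hQ' := h.conjTranspose_intertwines h1 hQ
  have hm0 : zeta3 ^ m ≠ 0 := pow_ne_zero _ (isPrimitiveRoot_zeta3.ne_zero (by norm_num))
  have hk0 : zeta3 ^ k ≠ 0 := pow_ne_zero _ (isPrimitiveRoot_zeta3.ne_zero (by norm_num))
  generalize zeta3 ^ m = x at *
  generalize zeta3 ^ k = y at *
  have e1 := smul_mul_of_evenArray hP
  have e2 := smul_mul_of_oddArray hQ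
  have hne : ∀ d i : Fin 3, ¬ (i = d + 1 ∧ i = d + 2) ∧ ¬ (i = d + 2 ∧ i = d + 1) := by decide
  -- The adjoint intertwiner at equal column indices: the array vanishes there, so the right-hand
  -- side is zero.
  have e3 : ∀ a i : Fin 3, star x ^ (a : ℕ) • (u (a + 1) i * u (a + 2) i) = 0 := fun a i => by
    have h2 := scalar_conjTranspose_mul_square_iff.1 hP' a i i
    simpa [evenArray, hne, ite_and, apply_ite star, -smul_eq_zero] using h2
  have e4 : ∀ a i : Fin 3, star y ^ (a : ℕ) • (u (a + 2) i * u (a + 1) i) = 0 := fun a i => by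
    have h2 := scalar_conjTranspose_mul_square_iff.1 hQ' a i i
    simpa [oddArray, hne, ite_and, apply_ite star, -smul_eq_zero] using h2
  -- Two entries on different diagonals lie either in one column, where the adjoint relations apply,
  -- or in different columns, where the relations `e1` and `e2` have zero right-hand side.
  have hcases : ∀ b i c j : Fin 3, b - i ≠ c - j →
      (∃ a, b = a + 1 ∧ c = a + 2 ∧ j = i) ∨ (∃ a, b = a + 2 ∧ c = a + 1 ∧ j = i) ∨
      (∃ d, i = d + 1 ∧ j = d + 2 ∧ c ≠ b + 1) ∨ (∃ d, i = d + 2 ∧ j = d + 1 ∧ c ≠ b + 2) := by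
    decide
  have hshift : ∀ a : Fin 3, a + 1 + 2 = a ∧ a + 2 + 1 = a ∧ a + 1 + 1 = a + 2 ∧
    a + 2 + 2 = a + 1 := by decide
  refine ⟨fun b i c j hne => ?_, fun a d => ?_, fun a d => ?_⟩
  · rcases hcases b i c j hne with ⟨a, rfl, rfl, rfl⟩ | ⟨a, rfl, rfl, rfl⟩ | ⟨d, rfl, rfl, hc⟩ |
      ⟨d, rfl, rfl, hc⟩
    · exact (smul_eq_zero.1 (e3 a _)).resolve_left (pow_ne_zero _ (star_ne_zero.2 hm0))
    · exact (smul_eq_zero.1 (e4 a _)).resolve_left (pow_ne_zero _ (star_ne_zero.2 hk0))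
    · have h2 := e1 b c d
      rw [if_neg hc] at h2
      exact (smul_eq_zero.1 h2).resolve_left (pow_ne_zero _ hm0)
    · have h2 := e2 b c d
      rw [if_neg hc] at h2
      exact (smul_eq_zero.1 h2).resolve_left (pow_ne_zero _ hk0)
  · rw [e1, (hshift a).2.2.1, if_pos rfl, (hshift a).1]
  · rw [e2, (hshift a).2.2.2, if_pos rfl, (hshift a).2.1]

end IsWoronowiczFamily

/-! ### Families supported on a cyclic permutation -/

section Monomial

variable {B : Type*} [Ring B] [StarRing B] [Algebra ℂ B]

/-- The matrix with the entries `v`, `w` and `c w* v*` at the places `(b, b + t)`. -/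
def monomialFamily (t : Fin 3) (c : ℂ) (v w : B) (b i : Fin 3) : B :=
  if i = b + t then ![v, w, c • (star w * star v)] b else 0

/-- The conditions on scalars under which a rotation pair with parameter `q` gives rise to a
monomial family for the array with parameters `x` and `y`. -/
structure IsShiftData (x y : ℂ) (t : Fin 3) (c q : ℂ) : Prop where
  even : ∀ d : Fin 3, x ^ ((d + t : Fin 3) : ℕ) * c = x ^ (d : ℕ)
  odd : ∀ d : Fin 3, y ^ ((d + t : Fin 3) : ℕ) * (c * q⁻¹) = y ^ (d : ℕ)
  star_mul_left : star c * c = 1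
  star_mul_right : star q * q = 1

theorem isShiftData_zero (x y : ℂ) : IsShiftData x y 0 1 1 := by
  constructor <;> simp

/-- The case `d = 0` of the conditions forces `c = x ^ (-t)` and `q = c * y ^ t`. The remaining
cases hold because exponents of `x` and `y` only matter modulo three. For `t = 2` this gives `c = x`
and `q = x * y⁻¹`. -/
theorem isShiftData_one {x y : ℂ} (hx : x ^ 3 = 1) (hy : y ^ 3 = 1) :
    IsShiftData x y 1 x⁻¹ (y * x⁻¹) := by
  have hx0 : x ≠ 0 := fun h => by simp [h] at hx
  have hy0 : y ≠ 0 := fun h => by simp [h] at hy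
  constructor
  · intro d; fin_cases d <;> simp <;> grind
  · intro d; fin_cases d <;> simp <;> grind
  · rw [star_inv₀, conj_eq_inv_of_pow_three hx, inv_inv, mul_inv_cancel₀ hx0]
  · rw [star_mul', star_inv₀, conj_eq_inv_of_pow_three hx, conj_eq_inv_of_pow_three hy]
    field_simp

theorem isShiftData_two {x y : ℂ} (hx : x ^ 3 = 1) (hy : y ^ 3 = 1) :
    IsShiftData x y 2 x (x * y⁻¹) := by
  have hx0 : x ≠ 0 := fun h => by simp [h] at hx
  have hy0 : y ≠ 0 := fun h => by simp [h] at hy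
  constructor
  · intro d; fin_cases d <;> simp <;> grind
  · intro d; fin_cases d <;> simp <;> grind
  · rw [conj_eq_inv_of_pow_three hx, inv_mul_cancel₀ hx0]
  · rw [star_mul', star_inv₀, conj_eq_inv_of_pow_three hx, conj_eq_inv_of_pow_three hy]
    field_simp

/-- For a monomial matrix every sum in the relations has at most one nonzero term. -/
theorem isWoronowiczFamily_of_unitary {E : Fin 3 → Fin 3 → Fin 3 → ℂ} {t : Fin 3} {V : Fin 3 → B}
    (hV : ∀ b, V b ∈ unitary B)
    (hE : ∀ a b c, E (a + t) (b + t) (c + t) • (V a * V b * V c) = E a b c • (1 : B)) :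
    IsWoronowiczFamily E fun b i => if i = b + t then V b else 0 := by
  refine ⟨fun j k => ?_, fun j k => ?_, fun a b c => ?_⟩
  · by_cases h : j = k
    · subst h
      simp [(hV _).2]
    · simp [h]
  · have h1 : ∀ t i s : Fin 3, i = s + t ↔ s = i - t := by decide
    by_cases h : j = k
    · subst h
      simp [h1 t, (hV _).1]
    · simp [h1 t, Ne.symm h, h]
  · simpa using hE a b c

namespace IsRotationPair

variable {q : ℂ} {v w : B}

theorem star_comm [StarModule ℂ B] (h : IsRotationPair q v w) (hq : star q * q = 1) :
    w * v = q⁻¹ • (v * w) ∧ star w * star v = q⁻¹ • (star v * star w) := by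
  have hq0 : q ≠ 0 := fun h0 => by simp [h0] at hq
  refine ⟨?_, ?_⟩
  · rw [h.comm, smul_smul, inv_mul_cancel₀ hq0, one_smul]
  · have h1 := congrArg star h.comm
    rwa [star_mul, star_smul, star_mul, eq_inv_of_mul_eq_one_left hq] at h1

/-- The products of the three entries in cyclic order all equal `c`, those in anticyclic order all
equal `c * q⁻¹`. The shift data say that these scalars compensate the change of the even and odd
coefficients under the index shift. -/
theorem isWoronowiczFamily [StarModule ℂ B] (h : IsRotationPair q v w) {p : ℂ} {k m : ℕ}
    {t : Fin 3} {c : ℂ} (hs : IsShiftData (zeta3 ^ m) (zeta3 ^ k) t c q) :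
    IsWoronowiczFamily (akmArray p k m) (monomialFamily t c v w) := by
  obtain ⟨h1, h2⟩ := h.star_comm hs.star_mul_right
  have hv := h.left.1
  have hv' := h.left.2
  have hw := h.right.1
  have hw' := h.right.2
  have hl : ∀ {a b : B}, a * b = 1 → ∀ z, a * (b * z) = z := fun hab z => by
    rw [← mul_assoc, hab, one_mul]
  refine isWoronowiczFamily_of_unitary (fun b => ?_) fun a b d => ?_
  · fin_cases b
    · exact h.left
    · exact h.right
    · refine Unitary.mem_iff.2 ⟨?_, ?_⟩
      · change star (c • (star w * star v)) * c • (star w * star v) = 1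
        simp only [star_smul, star_mul, star_star, smul_mul_smul_comm, mul_assoc, hl hw', hv',
          hs.star_mul_left, one_smul]
      · change c • (star w * star v) * star (c • (star w * star v)) = 1
        simp only [star_smul, star_mul, star_star, smul_mul_smul_comm, mul_assoc, hl hv, hw,
          mul_comm c (star c), hs.star_mul_left, one_smul]
  · set V : Fin 3 → B := ![v, w, c • (star w * star v)] with hV
    have heven : ∀ a : Fin 3, (V a * V (a + 1) * V (a + 2)) = c • (1 : B) := by
      intro a
      fin_cases a
      · simp [hV, mul_assoc, hl hw', hv']
      · simp [hV, hl hw', hv]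
      · simp [hV, mul_assoc, hl hv, hw]
    have hodd : ∀ a : Fin 3, (V a * V (a + 2) * V (a + 1)) = (c * q⁻¹) • (1 : B) := by
      intro a
      fin_cases a
      · simp [hV, h2, hl hv', hw, smul_smul]
      · simp [hV, ← mul_assoc, h1]
        simp [mul_assoc, hl hw', hv', smul_smul]
      · simp [hV, mul_assoc, h1]
        simp [hl hv, hw, smul_smul]
    simp only [akmArray_eq]
    have e1 : ∀ t a b : Fin 3,
        (b + t = a + t + 1 ↔ b = a + 1) ∧ (b + t = a + t + 2 ↔ b = a + 2) := by decide
    by_cases he : b = a + 1 ∧ d = a + 2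
    · obtain ⟨rfl, rfl⟩ := he
      rw [heven, smul_smul]
      simp [evenArray, oddArray, e1 t, hs.even]
    by_cases ho : b = a + 2 ∧ d = a + 1
    · obtain ⟨rfl, rfl⟩ := ho
      rw [hodd, smul_smul]
      simp [evenArray, oddArray, e1 t, mul_assoc, hs.odd]
    · simp [evenArray, oddArray, e1 t, he, ho]

end IsRotationPair

namespace IsWoronowiczFamily

variable [StarModule ℂ B] {p : ℂ} {k m : ℕ} {u : Fin 3 → Fin 3 → B} {t : Fin 3} {c q : ℂ}

/-- With `V b` the entry of row `b`, the adjoint relations for the last row read `V 0 * V 1 = c •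
star (V 2)` and `V 1 * V 0 = (c * q⁻¹) • star (V 2)`. Comparing them gives the commutation relation,
and the first determines `V 2`. -/
theorem isRotationPair_and_eq (hp : p ≠ 0) (hkm : ¬ k + m ≡ 0 [MOD 3])
    (h : IsWoronowiczFamily (akmArray p k m) u)
    (hs : IsShiftData (zeta3 ^ m) (zeta3 ^ k) t c q) (hu : ∀ b i, i ≠ b + t → u b i = 0) :
    IsRotationPair q (u 0 (0 + t)) (u 1 (1 + t)) ∧
      ∀ b i, u b i = monomialFamily t c (u 0 (0 + t)) (u 1 (1 + t)) b i := by
  obtain ⟨-, h1, h2⟩ := h.mul_eq_zero_and_star_eq hp hkm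
  have hunit : ∀ b, u b (b + t) ∈ unitary B := fun b => by
    refine Unitary.mem_iff.2 ⟨?_, ?_⟩
    · rw [← if_pos (rfl : b + t = b + t) (t := (1 : B)) (e := 0), ← h.star_mul]
      symm
      refine Finset.sum_eq_single b (fun s _ hsb => ?_) (by simp)
      rw [hu s _ fun h0 => hsb (add_right_cancel h0).symm, mul_zero]
    · rw [← if_pos (rfl : b = b) (t := (1 : B)) (e := 0), ← h.mul_star]
      symm
      refine Finset.sum_eq_single (b + t) (fun s _ hsb => ?_) (by simp)
      rw [hu b _ hsb, zero_mul]
  have hx0 : zeta3 ^ m ≠ 0 := pow_ne_zero _ (isPrimitiveRoot_zeta3.ne_zero (by norm_num))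
  have hy0 : zeta3 ^ k ≠ 0 := pow_ne_zero _ (isPrimitiveRoot_zeta3.ne_zero (by norm_num))
  have hc0 : c ≠ 0 := fun h0 => by simpa [h0] using hs.star_mul_left
  have hq0 : q ≠ 0 := fun h0 => by simpa [h0] using hs.star_mul_right
  have e1 : ∀ t : Fin 3, 2 + t + 1 = 0 + t ∧ 2 + t + 2 = 1 + t := by decide
  have h3 := h1 2 (2 + t)
  have h4 := h2 2 (2 + t)
  rw [(e1 t).1, (e1 t).2, ← hs.even 2, mul_smul] at h3
  rw [(e1 t).1, (e1 t).2, ← hs.odd 2, mul_smul] at h4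
  replace h3 : u 0 (0 + t) * u 1 (1 + t) = c • star (u 2 (2 + t)) :=
    smul_right_injective B (pow_ne_zero _ hx0) h3
  replace h4 : u 1 (1 + t) * u 0 (0 + t) = (c * q⁻¹) • star (u 2 (2 + t)) :=
    smul_right_injective B (pow_ne_zero _ hy0) h4
  refine ⟨⟨hunit 0, hunit 1, ?_⟩, fun b i => ?_⟩
  · rw [h3, h4, smul_smul]
    congr 1
    field_simp
  · by_cases hi : i = b + t
    · subst hi
      rw [monomialFamily, if_pos rfl]
      fin_cases b
      · rfl
      · rfl
      · have h5 := congrArg star h3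
        rw [StarMul.star_mul, star_smul, star_star] at h5
        change u 2 (2 + t) = c • _
        rw [h5, smul_smul, mul_comm, hs.star_mul_left, one_smul]
    · rw [hu b i hi, monomialFamily, if_neg hi]

end IsWoronowiczFamily

end Monomial

/-! ### The irreducible representations -/

section Classification

variable {H : Type*} [NormedAddCommGroup H] [InnerProductSpace ℂ H] [CompleteSpace H]
  {p : ℂ} {k m : ℕ}

/-- In an irreducible representation, the matrix `u` is supported on a cyclic permutation. -/
theorem IsIrreducibleRep.exists_shift (hp : p ≠ 0) (hkm : ¬ k + m ≡ 0 [MOD 3])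
    {π : AkmAlgebra p k m →⋆ₐ[ℂ] (H →L[ℂ] H)} (hπ : IsIrreducibleRep π) :
    ∃ t, ∀ b i, i ≠ b + t → π (akmU p k m b i) = 0 := by
  have := hπ.1
  have hu := isWoronowiczFamily_akmU π
  obtain ⟨h0, h1, -⟩ := hu.mul_eq_zero_and_star_eq hp hkm
  have hx0 : zeta3 ^ m ≠ 0 := pow_ne_zero _ (isPrimitiveRoot_zeta3.ne_zero (by norm_num))
  set u : Fin 3 → Fin 3 → (H →L[ℂ] H) := fun i j => π (akmU p k m i j)
  obtain ⟨b₀, i₀, hne⟩ : ∃ b i, u b i ≠ 0 := by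
    by_contra! h
    have h2 := hu.mul_star 0 0
    simp [h] at h2
  have hsub : ∀ t b i b' i' : Fin 3, i ≠ b + t → i' = b' + t → b - i ≠ b' - i' := by decide
  have hex : ∀ b i : Fin 3, i = b + (i - b) := by decide
  refine ⟨i₀ - b₀, ?_⟩
  set t := i₀ - b₀ with ht
  -- The common kernel of all entries off the diagonal `t`, the diagonal of a nonzero entry.
  let K : Submodule ℂ H := ⨅ x : {x : Fin 3 × Fin 3 // x.2 ≠ x.1 + t},
    LinearMap.ker (u x.1.1 x.1.2 : H →ₗ[ℂ] H)
  have hmem : ∀ h, h ∈ K ↔ ∀ b i, i ≠ b + t → u b i h = 0 := fun h => by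
    simp [K, Submodule.mem_iInf]
  have hK : IsClosed (K : Set H) := by
    have h2 : (K : Set H) = ⋂ x : {x : Fin 3 × Fin 3 // x.2 ≠ x.1 + t},
        (LinearMap.ker (u x.1.1 x.1.2 : H →ₗ[ℂ] H) : Set H) := Submodule.coe_iInf _
    rw [h2]
    exact isClosed_iInter fun x => (u x.1.1 x.1.2).isClosed_ker
  have hinv : ∀ b i, ∀ h ∈ K, u b i h ∈ K := fun b i h hh => by
    by_cases hi : i = b + t
    · refine (hmem _).2 fun b' i' hi' => ?_
      exact DFunLike.congr_fun (h0 b' i' b i (hsub t b' i' b i hi' hi)) h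
    · rw [(hmem h).1 hh b i hi]
      exact K.zero_mem
  -- Each adjoint is a scalar times a product of two entries, so invariance under the entries
  -- suffices.
  have hstar : ∀ b i, ∀ h ∈ K, star (u b i) h ∈ K := fun b i h hh => by
    have h2 : star (u b i) = ((zeta3 ^ m) ^ (b : ℕ))⁻¹ • (zeta3 ^ m) ^ (i : ℕ) •
        (u (b + 1) (i + 1) * u (b + 2) (i + 2)) := by
      rw [h1, smul_smul, inv_mul_cancel₀ (pow_ne_zero _ hx0), one_smul]
    rw [h2]
    exact K.smul_mem _ (K.smul_mem _ (hinv _ _ _ (hinv _ _ _ hh)))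
  rcases hπ.2 K hK (CStarPresentation.invariant_of_generators π hK (fun x => hinv x.1 x.2)
    (fun x => hstar x.1 x.2)) with h2 | h2
  · refine absurd ?_ hne
    ext h
    -- Entries off the diagonal annihilate the range of the nonzero entry, so `K` cannot be zero.
    have h3 : u b₀ i₀ h ∈ K := (hmem _).2 fun b' i' hi' =>
      DFunLike.congr_fun (h0 b' i' b₀ i₀ (hsub t b' i' b₀ i₀ hi' (hex b₀ i₀))) h
    rw [h2] at h3
    exact h3
  · intro b i hi
    ext h
    have h3 : h ∈ K := h2 ▸ Submodule.mem_top
    exact (hmem h).1 h3 b i hi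

/-- The monomial form of `u` in an irreducible representation. -/
theorem IsIrreducibleRep.exists_monomialFamily (hp : p ≠ 0) (hkm : ¬ k + m ≡ 0 [MOD 3])
    {π : AkmAlgebra p k m →⋆ₐ[ℂ] (H →L[ℂ] H)} (hπ : IsIrreducibleRep π) :
    ∃ v w : H →L[ℂ] H,
      (IsRotationPair 1 v w ∧ ∀ i j, π (akmU p k m i j) = monomialFamily 0 1 v w i j) ∨
      (IsRotationPair (zeta3 ^ k * (zeta3 ^ m)⁻¹) v w ∧
        ∀ i j, π (akmU p k m i j) = monomialFamily 1 (zeta3 ^ m)⁻¹ v w i j) ∨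
      (IsRotationPair (zeta3 ^ m * (zeta3 ^ k)⁻¹) v w ∧
        ∀ i j, π (akmU p k m i j) = monomialFamily 2 (zeta3 ^ m) v w i j) := by
  obtain ⟨t, ht⟩ := hπ.exists_shift hp hkm
  have hu := isWoronowiczFamily_akmU π
  have hx := zeta3_pow_pow_three m
  have hy := zeta3_pow_pow_three k
  refine ⟨π (akmU p k m 0 (0 + t)), π (akmU p k m 1 (1 + t)), ?_⟩
  obtain rfl | rfl | rfl : t = 0 ∨ t = 1 ∨ t = 2 :=
    (by decide : ∀ t : Fin 3, t = 0 ∨ t = 1 ∨ t = 2) t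
  · exact Or.inl (hu.isRotationPair_and_eq hp hkm (isShiftData_zero _ _) ht)
  · exact Or.inr (Or.inl (hu.isRotationPair_and_eq hp hkm (isShiftData_one hx hy) ht))
  · exact Or.inr (Or.inr (hu.isRotationPair_and_eq hp hkm (isShiftData_two hx hy) ht))

theorem isDiagonalRep_iff (π : AkmAlgebra p k m →⋆ₐ[ℂ] (H →L[ℂ] H)) (z₁ z₂ : ℂ) :
    IsDiagonalRep π z₁ z₂ ↔ ∀ i j, π (akmU p k m i j) = monomialFamily 0 1 (z₁ • 1) (z₂ • 1) i j := by
  simp [IsDiagonalRep, monomialFamily, Fin.forall_fin_succ, smul_smul]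
  grind

theorem isRep231_iff {θ : ℝ} (π : AkmAlgebra p k m →⋆ₐ[ℂ] (H →L[ℂ] H))
    (ρ : RotationAlgebra θ →⋆ₐ[ℂ] (H →L[ℂ] H)) :
    IsRep231 π ρ ↔ ∀ i j, π (akmU p k m i j) =
      monomialFamily 1 (zeta3 ^ m)⁻¹ (ρ (rotV1 θ)) (ρ (rotV2 θ)) i j := by
  simp [IsRep231, monomialFamily, Fin.forall_fin_succ, map_star]
  grind

theorem isRep312_iff {θ : ℝ} (π : AkmAlgebra p k m →⋆ₐ[ℂ] (H →L[ℂ] H))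
    (ρ : RotationAlgebra θ →⋆ₐ[ℂ] (H →L[ℂ] H)) :
    IsRep312 π ρ ↔ ∀ i j, π (akmU p k m i j) =
      monomialFamily 2 (zeta3 ^ m) (ρ (rotV1 θ)) (ρ (rotV2 θ)) i j := by
  simp [IsRep312, monomialFamily, Fin.forall_fin_succ, map_star]
  grind

/-- Matches the angle of the rotation algebra with the parameter `q` of the shift data for `t = 1`;
exchanging `k` and `m` gives `t = 2`. -/
theorem exp_two_pi_mul_sub_div_three (k m : ℕ) :
    Complex.exp (2 * Real.pi * Complex.I * ((((k : ℝ) - m) / 3 : ℝ) : ℂ)) =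
      zeta3 ^ k * (zeta3 ^ m)⁻¹ := by
  rw [zeta3, ← Complex.exp_nat_mul, ← Complex.exp_nat_mul, ← Complex.exp_neg, ← Complex.exp_add]
  congr 1
  push_cast
  ring

theorem isRotationPair_smul_one {B : Type*} [CStarAlgebra B] {z₁ z₂ : ℂ} (h₁ : ‖z₁‖ = 1)
    (h₂ : ‖z₂‖ = 1) : IsRotationPair 1 (z₁ • (1 : B)) (z₂ • 1) := by
  have h : ∀ z : ℂ, ‖z‖ = 1 → z • (1 : B) ∈ unitary B := fun z hz => by
    have h1 : star z * z = 1 := by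
      rw [Complex.star_def, mul_comm, Complex.mul_conj, Complex.normSq_eq_norm_sq, hz]
      norm_num
    refine Unitary.mem_iff.2 ⟨?_, ?_⟩
    · rw [star_smul, star_one, smul_mul_smul_comm, h1, one_smul, one_mul]
    · rw [star_smul, star_one, smul_mul_smul_comm, mul_comm z, h1, one_smul, one_mul]
  refine ⟨h _ h₁, h _ h₂, ?_⟩
  rw [one_smul, smul_mul_smul_comm, smul_mul_smul_comm, mul_comm z₁]

/-- A monomial family which comes from a rotation pair is given by a unique representation. -/
theorem IsRotationPair.existsUnique_akm_hom {q c : ℂ} {v w : H →L[ℂ] H} {t : Fin 3}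
    (h : IsRotationPair q v w) (hs : IsShiftData (zeta3 ^ m) (zeta3 ^ k) t c q) :
    ∃! π : AkmAlgebra p k m →⋆ₐ[ℂ] (H →L[ℂ] H), ∀ i j,
      π (akmU p k m i j) = monomialFamily t c v w i j :=
  _root_.existsUnique_akm_hom (h.isWoronowiczFamily hs)

/-- A monomial irreducible representation comes from an irreducible representation of a rotation
algebra. -/
theorem IsIrreducibleRep.exists_rotation {π : AkmAlgebra p k m →⋆ₐ[ℂ] (H →L[ℂ] H)}
    (hπ : IsIrreducibleRep π) {t : Fin 3} {c : ℂ} {v w : H →L[ℂ] H} {θ : ℝ}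
    (h : IsRotationPair (Complex.exp (2 * Real.pi * Complex.I * θ)) v w)
    (hu : ∀ i j, π (akmU p k m i j) = monomialFamily t c v w i j) :
    ∃ ρ : RotationAlgebra θ →⋆ₐ[ℂ] (H →L[ℂ] H), IsIrreducibleRep ρ ∧
      ρ (rotV1 θ) = v ∧ ρ (rotV2 θ) = w := by
  obtain ⟨ρ, ⟨h1, h2⟩, -⟩ := existsUnique_rotation_hom h
  refine ⟨ρ, hπ.of_generators ρ fun x => ?_, h1, h2⟩
  suffices h3 : ∃ a, ρ a = monomialFamily t c v w x.1 x.2 by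
    obtain ⟨a, ha⟩ := h3
    exact ⟨a, ha.trans (hu x.1 x.2).symm⟩
  obtain ⟨b, i⟩ := x
  unfold monomialFamily
  split_ifs
  · fin_cases b
    · exact ⟨_, h1⟩
    · exact ⟨_, h2⟩
    · refine ⟨c • (star (rotV2 θ) * star (rotV1 θ)), ?_⟩
      rw [map_smul, map_mul, map_star, map_star, h1, h2]
      rfl
  · exact ⟨0, map_zero ρ⟩

/-- A monomial representation is irreducible if the rotation algebra acts irreducibly. -/
theorem IsIrreducibleRep.of_monomialFamily {θ : ℝ}
    {ρ : RotationAlgebra θ →⋆ₐ[ℂ] (H →L[ℂ] H)} (hρ : IsIrreducibleRep ρ)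
    {π : AkmAlgebra p k m →⋆ₐ[ℂ] (H →L[ℂ] H)} {t : Fin 3} {c : ℂ}
    (hu : ∀ i j, π (akmU p k m i j) =
      monomialFamily t c (ρ (rotV1 θ)) (ρ (rotV2 θ)) i j) : IsIrreducibleRep π := by
  refine hρ.of_generators π fun x => ?_
  fin_cases x
  · exact ⟨akmU p k m 0 (0 + t), (hu _ _).trans (if_pos rfl)⟩
  · exact ⟨akmU p k m 1 (1 + t), (hu _ _).trans (if_pos rfl)⟩

/-- Commuting unitaries which generate an irreducible representation are scalars, and the space is
one-dimensional. -/
theorem IsIrreducibleRep.exists_scalars {π : AkmAlgebra p k m →⋆ₐ[ℂ] (H →L[ℂ] H)}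
    (hπ : IsIrreducibleRep π) {t : Fin 3} {c : ℂ} {v w : H →L[ℂ] H} (h : IsRotationPair 1 v w)
    (hu : ∀ i j, π (akmU p k m i j) = monomialFamily t c v w i j) :
    Module.finrank ℂ H = 1 ∧ ∃ z₁ z₂ : ℂ, ‖z₁‖ = 1 ∧ ‖z₂‖ = 1 ∧ v = z₁ • 1 ∧ w = z₂ • 1 := by
  have := hπ.1
  have hvw : Commute v w := h.comm.trans (one_smul ℂ _)
  -- For unitary `b`, conjugating `b * a = a * b` by `star b` is enough.
  have hstar : ∀ {a b : H →L[ℂ] H}, b ∈ unitary (H →L[ℂ] H) → Commute a b → Commute a (star b) :=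
    fun {a b} hb hab => by
      have h1 : star b * (b * a) * star b = star b * (a * b) * star b := by rw [hab.eq]
      rw [← mul_assoc, hb.1, one_mul, mul_assoc, mul_assoc, hb.2, mul_one] at h1
      exact h1
  -- Applied to `v` and `w` themselves: they commute, so each is an intertwiner and Schur's lemma
  -- for normal operators applies.
  have key : ∀ T : H →L[ℂ] H, T ∈ unitary (H →L[ℂ] H) → Commute T v → Commute T w →
      ∃ z : ℂ, ‖z‖ = 1 ∧ T = z • 1 := by
    intro T hT hv hw
    have hv' := hstar h.left hv
    have hw' := hstar h.right hw
    have h1 : ∀ a, Commute T (π a) := by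
      refine CStarPresentation.commute_hom π T (fun x => ?_) (fun x => ?_)
      · change Commute T (π (akmU p k m x.1 x.2))
        rw [hu]
        unfold monomialFamily
        split_ifs
        · obtain ⟨b, i⟩ := x
          fin_cases b
          · exact hv
          · exact hw
          · exact (hw'.mul_right hv').smul_right c
        · exact Commute.zero_right T
      · change Commute T (star (π (akmU p k m x.1 x.2)))
        rw [hu]
        unfold monomialFamily
        split_ifs
        · obtain ⟨b, i⟩ := x
          fin_cases b
          · exact hv'
          · exact hw'
          · change Commute T (star (c • (star w * star v)))
            rw [star_smul, star_mul, star_star, star_star]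
            exact (hv.mul_right hw).smul_right _
        · rw [star_zero]
          exact Commute.zero_right T
    have h2 : ∀ a, Commute (star T) (π a) := fun a => by
      have h3 := (h1 (star a)).star_star
      rwa [map_star, star_star] at h3
    have : IsStarNormal T := ⟨hT.1.trans hT.2.symm⟩
    obtain ⟨z, rfl⟩ := hπ.exists_eq_smul_one h1 h2
    refine ⟨z, ?_, rfl⟩
    have h4 := CStarRing.norm_of_mem_unitary hT
    rwa [norm_smul, norm_one, mul_one] at h4
  obtain ⟨z₁, hz₁, rfl⟩ := key v h.left (Commute.refl v) hvw
  obtain ⟨z₂, hz₂, rfl⟩ := key w h.right hvw.symm (Commute.refl w)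
  refine ⟨hπ.finrank_eq_one fun x => ?_, z₁, z₂, hz₁, hz₂, rfl, rfl⟩
  suffices h3 : ∃ z : ℂ, monomialFamily t c (z₁ • 1) (z₂ • 1) x.1 x.2 = z • (1 : H →L[ℂ] H) by
    obtain ⟨z, hz⟩ := h3
    exact ⟨z, (hu x.1 x.2).trans hz⟩
  obtain ⟨b, i⟩ := x
  unfold monomialFamily
  split_ifs
  · fin_cases b
    · exact ⟨z₁, rfl⟩
    · exact ⟨z₂, rfl⟩
    · refine ⟨c * (star z₂ * star z₁), ?_⟩
      change c • (star (z₂ • 1) * star (z₁ • 1)) = _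
      rw [star_smul, star_smul, star_one, smul_mul_smul_comm, one_mul, smul_smul]
  · exact ⟨0, (zero_smul _ _).symm⟩

end Classification

end

theorem mainTheorem3 (p : ℂ) (hp : p ≠ 0) (k m : ℕ) (hk : k < 3) (hm : m < 3)
    (hkm : ¬ k + m ≡ 0 [MOD 3])
    {H : Type*} [NormedAddCommGroup H] [InnerProductSpace ℂ H] [CompleteSpace H] :
    -- the irreducible representations on `H` are exactly the members of the three families
    (∀ π : AkmAlgebra p k m →⋆ₐ[ℂ] (H →L[ℂ] H), IsIrreducibleRep π ↔
      ((Module.finrank ℂ H = 1 ∧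
          ∃ z₁ z₂ : ℂ, ‖z₁‖ = 1 ∧ ‖z₂‖ = 1 ∧ IsDiagonalRep π z₁ z₂) ∨
        (∃ ρ : RotationAlgebra (((k : ℝ) - m) / 3) →⋆ₐ[ℂ] (H →L[ℂ] H),
          IsIrreducibleRep ρ ∧ IsRep231 π ρ) ∨
        (∃ ρ : RotationAlgebra (((m : ℝ) - k) / 3) →⋆ₐ[ℂ] (H →L[ℂ] H),
          IsIrreducibleRep ρ ∧ IsRep312 π ρ))) ∧
    -- all values of the parameters occur, and they determine the representation
    (Module.finrank ℂ H = 1 → ∀ z₁ z₂ : ℂ, ‖z₁‖ = 1 → ‖z₂‖ = 1 →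
      ∃! π : AkmAlgebra p k m →⋆ₐ[ℂ] (H →L[ℂ] H), IsDiagonalRep π z₁ z₂) ∧
    (∀ ρ : RotationAlgebra (((k : ℝ) - m) / 3) →⋆ₐ[ℂ] (H →L[ℂ] H), IsIrreducibleRep ρ →
      ∃! π : AkmAlgebra p k m →⋆ₐ[ℂ] (H →L[ℂ] H), IsRep231 π ρ) ∧
    (∀ ρ : RotationAlgebra (((m : ℝ) - k) / 3) →⋆ₐ[ℂ] (H →L[ℂ] H), IsIrreducibleRep ρ →
      ∃! π : AkmAlgebra p k m →⋆ₐ[ℂ] (H →L[ℂ] H), IsRep312 π ρ) := by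
  have hx := zeta3_pow_pow_three m
  have hy := zeta3_pow_pow_three k
  simp only [isDiagonalRep_iff, isRep231_iff, isRep312_iff]
  refine ⟨fun π => ⟨fun hπ => ?_, ?_⟩, fun _ z₁ z₂ h₁ h₂ => ?_, fun ρ _ => ?_, fun ρ _ => ?_⟩
  · obtain ⟨v, w, ⟨h, hu⟩ | ⟨h, hu⟩ | ⟨h, hu⟩⟩ := hπ.exists_monomialFamily hp hkm
    · obtain ⟨hH, z₁, z₂, h₁, h₂, rfl, rfl⟩ := hπ.exists_scalars h hu
      exact Or.inl ⟨hH, z₁, z₂, h₁, h₂, hu⟩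
    · rw [← exp_two_pi_mul_sub_div_three] at h
      obtain ⟨ρ, hρ, rfl, rfl⟩ := hπ.exists_rotation h hu
      exact Or.inr (Or.inl ⟨ρ, hρ, hu⟩)
    · rw [← exp_two_pi_mul_sub_div_three] at h
      obtain ⟨ρ, hρ, rfl, rfl⟩ := hπ.exists_rotation h hu
      exact Or.inr (Or.inr ⟨ρ, hρ, hu⟩)
  · rintro (⟨hH, -⟩ | ⟨ρ, hρ, hu⟩ | ⟨ρ, hρ, hu⟩)
    · exact IsIrreducibleRep.of_finrank_eq_one π hH
    · exact hρ.of_monomialFamily hu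
    · exact hρ.of_monomialFamily hu
  · exact (isRotationPair_smul_one h₁ h₂).existsUnique_akm_hom (isShiftData_zero _ _)
  · have h := isRotationPair_rotV ρ
    rw [exp_two_pi_mul_sub_div_three] at h
    exact h.existsUnique_akm_hom (isShiftData_one hx hy)
  · have h := isRotationPair_rotV ρ
    rw [exp_two_pi_mul_sub_div_three] at h
    exact h.existsUnique_akm_hom (isShiftData_two hx hy)
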